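/- **Setting.** A directed underlay network has finitely many links $\underline e$ with capacities $C_{\underline e}>0$. On it runs an overlay of $m\ge 1$ agents $V$ with a base topology whose set of undirected links is $\widetilde E$; $E$ is the set of the corresponding directed links. Each $(i,j)\in E$ has an underlay routing path $\underline p_{i,j}$ and a propagation delay $l_{i,j}\ge 0$; agent $i$ has a parameter vector of size $\kappa_i>0$. For $F\subseteq E$ let $\Gamma_F$ be the set of underlay links lying on $\underline p_{i,j}$ for every $(i,j)\in F$ and for no $(i,j)\in E\setminus F$; let $\mathcal F=\{F\subseteq E: F\ne\emptyset,\ \Gamma_F\neq\emptyset\}$ and $C_F=\min_{\underline e\in\Gamma_F}C_{\underline e}$. Tomography returns a family $\widehat{\mathcal F}$ of subsets of $E$ and numbers $\widehat C_F>0$ ($F\in\widehat{\mathcal F}$). **Schedule.** A set $E_a\subseteq\widetilde E$ of activated links triggers the set $H$ of multicast flows $h$, one from each agent $s_h$ with an activated neighbour to the set $T_h$ of all its activated neighbours, of size $\kappa_h=\kappa_{s_h}$. A schedule consists of $z^h_{ij},r^{h,k}_{ij}\in\{0,1\}$, $d_h\in(0,M]$, $f^h_{ij}\ge 0$ ($h\in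 H$, $k\in T_h$, $(i,j)\in E$) with $$\sum_{j}r^{h,k}_{ij}=\sum_j r^{h,k}_{ji}+b^{h,k}_i,\quad r^{h,k}_{ij}\le z^h_{ij},\quad d_h-M(1-z^h_{ij})\le f^h_{ij}\le d_h,\quad f^h_{ij}\le Mz^h_{ij},$$ where $b^{h,k}_i=1$ if $i=s_h$, $-1$ if $i=k$, $0$ otherwise, and $M$ is an upper bound on the attainable rates $d_h$. It has iteration time $\tau\geq 0$ if $\kappa_h/d_h+\sum_{(i,j)\in E}l_{i,j}r^{h,k}_{ij}\le\tau$ for all $h\in H,k\in T_h$. It is feasible for the underlay if $\sum_{(i,j)\in E:\,\underline e\in\underline p_{i,j}}\sum_h f^h_{ij}\le C_{\underline e}$ for all $\underline e$. The designed schedule minimizes $\tau$ subject to the inferred constraints $\sum_{(i,j)\in F}\sum_h f^h_{ij}\le\widehat C_F$ ($F\in\widehat{\mathcal F}$) instead. Let $\overline\tau(E_a)$ be the minimum (infimum) of the $\tau\ge 0$ exceeding $l_{i,j}$ and $l_{j,i}$ for all $(i,j)\in E_a$ with $$\sum_{(i,j)\in E_a}\Big(\tfrac{\kappa_i}{\tau-l_{i,j}}\mathbb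 1_{(i,j)\in F}+\tfrac{\kappa_j}{\tau-l_{j,i}}\mathbb 1_{(j,i)\in F}\Big)\le\widehat C_F\quad\text{for all }F\in\widehat{\mathcal F}.$$ **Weights.** Let $B$ be the oriented incidence matrix of $\widetilde E$ and $J=\frac1m\mathbf 1\mathbf 1^\top$. The designed mixing matrix is $W^*=I-B\,\mathrm{diag}(\alpha^*)B^\top$, where $\alpha^*$ minimizes $\rho$ subject to $-\rho I\preceq I-B\,\mathrm{diag}(\alpha)B^\top-J\preceq\rho I$ and $\alpha_{ij}=0$ for $(i,j)\notin E_a$. For predetermined weights $\alpha^{(0)}$, let $\alpha^{(0)}(E_a)$ agree with $\alpha^{(0)}$ on $E_a$ and vanish elsewhere, and let $\overline\rho(E_a)=\|I-B\,\mathrm{diag}(\alpha^{(0)}(E_a))B^\top-J\|$ (spectral norm). **Learning.** Agent $i$ has a differentiable objective $F_i:\mathbb R^d\to\mathbb R$; $F=\frac1m\sum_iF_i\ge F_{\inf}$. The stochastic gradients satisfy $\mathbb E[g(x;\xi_i)]=\nabla F_i(x)$, and the mini-batches $\xi_i^{(k)}$ are independent over $i$ and $k$, with $\xi_i^{(k)}$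 distributed as $\xi_i$. For constants $l>0$, $\widehat\sigma,\widehat\zeta,M_1,M_2\ge 0$: (1) each $\nabla F_i$ is $l$-Lipschitz; (2) $\frac1m\sum_i\mathbb E\|g(x_i;\xi_i)-\nabla F_i(x_i)\|^2\le\widehat\sigma^2+\frac{M_1}m\sum_i\|\nabla F(x_i)\|^2$ for all $x_1,\dots,x_m$ (with all these expectations finite); (3) $\frac1m\sum_i\|\nabla F_i(x)\|^2\le\widehat\zeta^2+M_2\|\nabla F(x)\|^2$ for all $x$. D-PSGD under the design starts from a common $x_i^{(1)}=x^{(1)}$ and iterates $x_i^{(k+1)}=\sum_jW^*_{ij}x_j^{(k)}-\eta\,g(x_i^{(k)};\xi_i^{(k)})$, with a learning rate $\eta>0$. Let $\overline x^{(k)}=\frac1m\sum_ix_i^{(k)}$ and, for $p\in(0,1]$, $\epsilon_0>0$ and $c>0$, $$K(p)=c\,l\,(F(x^{(1)})-F_{\inf})\left(\frac{\widehat\sigma^2}{m\epsilon_0^2}+\frac{\widehat\zeta\sqrt{M_1+1}+\widehat\sigma\sqrt p}{p\,\epsilon_0^{3/2}}+\frac{\sqrt{(M_2+1)(M_1+1)}}{p\,\epsilon_0}\right).$$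 **Theorem.** For every $M_1\ge 0$ there is a constant $c>0$ depending only on $M_1$ such that the following holds in the setting above, with $K(\cdot)$ formed with this $c$. Assume $\widehat{\mathcal F}\supseteq\mathcal F$ and $\widehat C_F\le C_F$ for all $F\in\mathcal F$. Let $E_a^*\subseteq\widetilde E$ be the set of links activated by the proposed solution (any set with $\overline\rho(E_a^*)<1$), and put $\overline K(E_a^*)=K(1-\overline\rho(E_a^*)^2)$. Then D-PSGD under the corresponding design reaches $\epsilon_0$-convergence within time $\overline\tau(E_a^*)\cdot\overline K(E_a^*)$. That is: the designed schedule, with its optimal iteration time $\tau$, is feasible for the true underlay, so every iteration completes within time $\tau$; and there are a learning rate $\eta>0$ and a number of iterations $N\le\overline K(E_a^*)$ with $N\tau\le\overline\tau(E_a^*)\,\overline K(E_a^*)$ such that $\frac1K\sum_{k=1}^K\mathbb E\|\nabla F(\overline x^{(k)})\|^2\le\epsilon_0$ for every integer $K\ge\max(N,1)$. -/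

import Mathlib

open MeasureTheory ProbabilityTheory
open scoped Matrix

/-! ### The underlay, the overlay and the tomography output -/

/-- A directed communication underlay with nodes `Node` and links `Link`. -/
structure Underlay (Node Link : Type*) where
  src : Link → Node
  tgt : Link → Node
  cap : Link → ℝ
  cap_pos : ∀ e, 0 < cap e

/-- `U.IsRoute p u v`: the list of links `p` is a directed route from `u` to `v`. -/
def Underlay.IsRoute {Node Link : Type*} (U : Underlay Node Link) :
    List Link → Node → Node → Prop
  | [], u, v => u = v
  | e :: p, u, v => U.src e = u ∧ U.IsRoute p (U.tgt e) v

/-- An overlay of `m` agents on the underlay `U`. The undirected overlay links are the edges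
of the base topology `base`; the directed overlay links are its ordered adjacent pairs.
`host i` is the node running agent `i`, `route i j` and `delay i j` are the underlay routing path
and the propagation delay of the overlay link `(i, j)`, and `size i` is the size of the
parameter vector of agent `i`. -/
structure Overlay (m : ℕ) {Node Link : Type*} (U : Underlay Node Link) where
  base : SimpleGraph (Fin m)
  host : Fin m → Node
  route : Fin m → Fin m → List Link
  route_isRoute : ∀ i j, base.Adj i j → U.IsRoute (route i j) (host i) (host j)
  delay : Fin m → Fin m → ℝ
  delay_nonneg : ∀ i j, 0 ≤ delay i j
  size : Fin m → ℝ
  size_pos : ∀ i, 0 < size i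

namespace Overlay

variable {m : ℕ} {Node Link : Type*} {U : Underlay Node Link}

open Classical in
/-- The set of directed overlay links. -/
noncomputable def links (O : Overlay m U) : Finset (Fin m × Fin m) :=
  Finset.univ.filter fun q => O.base.Adj q.1 q.2

/-- The category of underlay links of a set `F` of directed overlay links: the underlay links
traversed by and only by the routing paths of the overlay links in `F`. -/
def category (O : Overlay m U) (F : Finset (Fin m × Fin m)) : Set Link :=
  {e | (∀ q ∈ F, e ∈ O.route q.1 q.2) ∧ ∀ q ∈ O.links, q ∉ F → e ∉ O.route q.1 q.2}

/-- The sets of overlay links that index a nonempty category. -/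
def nonemptyCategories (O : Overlay m U) : Set (Finset (Fin m × Fin m)) :=
  {F | F ⊆ O.links ∧ (O.category F).Nonempty}

/-- The category capacity: the minimum capacity of the links in the category. -/
noncomputable def categoryCap (O : Overlay m U) (F : Finset (Fin m × Fin m)) : ℝ :=
  sInf (U.cap '' O.category F)

end Overlay

/-- The output of network tomography: the detected category indices and their inferred
(positive) capacities. -/
structure Tomography {m : ℕ} {Node Link : Type*} {U : Underlay Node Link}
    (O : Overlay m U) where
  detected : Finset (Finset (Fin m × Fin m))
  detected_subset : ∀ F ∈ detected, F ⊆ O.links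
  cap : Finset (Fin m × Fin m) → ℝ
  cap_pos : ∀ F ∈ detected, 0 < cap F

/-! ### Communication schedules

The set of activated (undirected) links is given as a graph `A ≤ O.base`. It triggers one multicast
flow for each agent `h` with at least one activated neighbour; the flow is named after its
source `h`, its destinations are the activated neighbours of `h`, and its size is `O.size h`. -/

/-- The sources of the multicast flows triggered by the activated links. -/
noncomputable def flowSources {m : ℕ} (A : SimpleGraph (Fin m)) : Finset (Fin m) :=
  open Classical in Finset.univ.filter fun h => ∃ k, A.Adj h k

/-- The decision variables of the scheduling problem: `z h i j` (flow `h` traverses the overlay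
link `(i, j)`), `r h k i j` (the flow from `h` to `k` traverses `(i, j)`), the rate `d h` of flow
`h`, and the rate `f h i j` of flow `h` on `(i, j)`. -/
structure Schedule (m : ℕ) where
  z : Fin m → Fin m → Fin m → ℝ
  r : Fin m → Fin m → Fin m → Fin m → ℝ
  d : Fin m → ℝ
  f : Fin m → Fin m → Fin m → ℝ

namespace Schedule

variable {m : ℕ} {Node Link : Type*} {U : Underlay Node Link}

open Classical in
/-- All constraints of the scheduling problem other than the capacity constraint: `s` serves all
the flows triggered by `A` within time `τ`. A positive rate is required in the time constraint,
where a flow of rate `0` would take infinite time; a completion time is nonnegative (this only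
matters if there is no flow at all). `M` is the big-M constant bounding the rates. -/
structure Serves (s : Schedule m) (O : Overlay m U) (A : SimpleGraph (Fin m)) (M τ : ℝ) :
    Prop where
  time_nonneg : 0 ≤ τ
  time : ∀ h k, A.Adj h k →
    0 < s.d h ∧ O.size h / s.d h + ∑ q ∈ O.links, O.delay q.1 q.2 * s.r h k q.1 q.2 ≤ τ
  conservation : ∀ h k, A.Adj h k → ∀ i,
    ∑ j ∈ Finset.univ.filter (fun j => (i, j) ∈ O.links), s.r h k i j =
      ∑ j ∈ Finset.univ.filter (fun j => (j, i) ∈ O.links), s.r h k j i +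
        (if i = h then 1 else if i = k then -1 else 0)
  tree : ∀ h k, A.Adj h k → ∀ q ∈ O.links, s.r h k q.1 q.2 ≤ s.z h q.1 q.2
  rate_lower : ∀ h ∈ flowSources A, ∀ q ∈ O.links,
    s.d h - M * (1 - s.z h q.1 q.2) ≤ s.f h q.1 q.2
  rate_upper : ∀ h ∈ flowSources A, ∀ q ∈ O.links, s.f h q.1 q.2 ≤ s.d h
  no_flow : ∀ h ∈ flowSources A, ∀ q ∈ O.links, s.f h q.1 q.2 ≤ M * s.z h q.1 q.2
  r_binary : ∀ h k, A.Adj h k → ∀ q ∈ O.links, s.r h k q.1 q.2 = 0 ∨ s.r h k q.1 q.2 = 1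
  z_binary : ∀ h ∈ flowSources A, ∀ q ∈ O.links, s.z h q.1 q.2 = 0 ∨ s.z h q.1 q.2 = 1
  d_mem : ∀ h ∈ flowSources A, s.d h ∈ Set.Icc 0 M
  f_nonneg : ∀ h ∈ flowSources A, ∀ q ∈ O.links, 0 ≤ s.f h q.1 q.2

open Classical in
/-- The true capacity constraint: the traffic on every underlay link is within its capacity. -/
def RespectsUnderlay (s : Schedule m) (O : Overlay m U) (A : SimpleGraph (Fin m)) : Prop :=
  ∀ e : Link, ∑ q ∈ O.links.filter (fun q => e ∈ O.route q.1 q.2),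
    ∑ h ∈ flowSources A, s.f h q.1 q.2 ≤ U.cap e

/-- The inferred per-category capacity constraint. -/
def RespectsInferred (s : Schedule m) {O : Overlay m U} (T : Tomography O)
    (A : SimpleGraph (Fin m)) : Prop :=
  ∀ F ∈ T.detected, ∑ q ∈ F, ∑ h ∈ flowSources A, s.f h q.1 q.2 ≤ T.cap F

/-- `s`, with predicted iteration time `τ`, is feasible for the scheduling problem in which the
true capacity constraint is replaced by the inferred one. -/
def FeasibleInferred (s : Schedule m) {O : Overlay m U} (T : Tomography O)
    (A : SimpleGraph (Fin m)) (M τ : ℝ) : Prop :=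
  s.Serves O A M τ ∧ s.RespectsInferred T A

/-- `s` is an optimal solution, with optimal value `τ`, to the scheduling problem with the
inferred capacity constraint. -/
def IsOptimal (s : Schedule m) {O : Overlay m U} (T : Tomography O)
    (A : SimpleGraph (Fin m)) (M τ : ℝ) : Prop :=
  s.FeasibleInferred T A M τ ∧
    ∀ (s' : Schedule m) (τ' : ℝ), s'.FeasibleInferred T A M τ' → τ ≤ τ'

end Schedule

/-- `M` is an upper bound on the flow rates: no solution of the scheduling problem with the inferred
capacity constraint, whatever big-M constant it is written with, has a flow of rate above `M`. -/
def IsRateBound {m : ℕ} {Node Link : Type*} {U : Underlay Node Link} {O : Overlay m U}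
    (T : Tomography O) (A : SimpleGraph (Fin m)) (M : ℝ) : Prop :=
  ∀ (M' τ : ℝ) (s : Schedule m), s.FeasibleInferred T A M' τ → ∀ h ∈ flowSources A, s.d h ≤ M

open Classical in
/-- The upper bound on the time per iteration obtained by direct transmission: the minimum `τ`
such that sending at rate `size i / (τ - delay i j)` over each activated link, in both directions,
meets the inferred capacity constraint. -/
noncomputable def tauBar {m : ℕ} {Node Link : Type*} {U : Underlay Node Link} {O : Overlay m U}
    (T : Tomography O) (A : SimpleGraph (Fin m)) : ℝ :=
  sInf {τ : ℝ | 0 ≤ τ ∧ (∀ i j, A.Adj i j → O.delay i j < τ) ∧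
    ∀ F ∈ T.detected, ∑ q ∈ F.filter (fun q => A.Adj q.1 q.2),
      O.size q.1 / (τ - O.delay q.1 q.2) ≤ T.cap F}

/-! ### Mixing matrices and link weights -/

/-- The incidence matrix of `G`; the edge `{i, j}` with `i < j` is oriented from `i` to `j`. -/
noncomputable def orientedInc {m : ℕ} (G : SimpleGraph (Fin m)) :
    Matrix (Fin m) G.edgeSet ℝ :=
  Matrix.of fun i e => if i = (e : Sym2 (Fin m)).inf then 1
    else if i = (e : Sym2 (Fin m)).sup then -1 else 0

open Classical in
/-- The weighted Laplacian `B diag(α) Bᵀ`. -/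
noncomputable def weightedLap {m : ℕ} (G : SimpleGraph (Fin m)) (α : G.edgeSet → ℝ) :
    Matrix (Fin m) (Fin m) ℝ :=
  orientedInc G * Matrix.diagonal α * (orientedInc G)ᵀ

/-- The mixing matrix `W = I - B diag(α) Bᵀ` with link weights `α`. -/
noncomputable def mixingMatrix {m : ℕ} (G : SimpleGraph (Fin m)) (α : G.edgeSet → ℝ) :
    Matrix (Fin m) (Fin m) ℝ :=
  1 - weightedLap G α

/-- The ideal mixing matrix `J = (1/m) 1 1ᵀ`. -/
noncomputable def idealMatrix (m : ℕ) : Matrix (Fin m) (Fin m) ℝ :=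
  Matrix.of fun _ _ => 1 / (m : ℝ)

/-- The spectral norm of a matrix. -/
noncomputable def matSpectralNorm {m : ℕ} (A : Matrix (Fin m) (Fin m) ℝ) : ℝ :=
  ‖Matrix.toEuclideanCLM (n := Fin m) (𝕜 := ℝ) A‖

/-- `(α, ρ)` is feasible for the link weight SDP: `-ρ I ⪯ W - J ⪯ ρ I`, and only activated links
have nonzero weights. -/
def FeasibleWeights {m : ℕ} (G A : SimpleGraph (Fin m)) (α : G.edgeSet → ℝ) (ρ : ℝ) : Prop :=
  (mixingMatrix G α - idealMatrix m - (-ρ) • (1 : Matrix (Fin m) (Fin m) ℝ)).PosSemidef ∧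
  (ρ • (1 : Matrix (Fin m) (Fin m) ℝ) - (mixingMatrix G α - idealMatrix m)).PosSemidef ∧
  ∀ e : G.edgeSet, (e : Sym2 (Fin m)) ∉ A.edgeSet → α e = 0

/-- `α` is an optimal solution to the link weight SDP, which minimizes `ρ`. -/
def IsOptimalWeights {m : ℕ} (G A : SimpleGraph (Fin m)) (α : G.edgeSet → ℝ) : Prop :=
  ∃ ρ, FeasibleWeights G A α ρ ∧ ∀ α' ρ', FeasibleWeights G A α' ρ' → ρ ≤ ρ'

open Classical in
/-- The restriction of predetermined link weights to the activated links. -/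
noncomputable def restrictWeights {m : ℕ} (G A : SimpleGraph (Fin m)) (α : G.edgeSet → ℝ) :
    G.edgeSet → ℝ :=
  fun e => if (e : Sym2 (Fin m)) ∈ A.edgeSet then α e else 0

/-- `ρ̄ = ‖I - L(E_a) - J‖` for the predetermined link weights `α₀` restricted to `A`. -/
noncomputable def rhoBar {m : ℕ} (G A : SimpleGraph (Fin m)) (α₀ : G.edgeSet → ℝ) : ℝ :=
  matSpectralNorm (1 - weightedLap G (restrictWeights G A α₀) - idealMatrix m)

/-! ### Decentralized learning -/

/-- The parameter space `ℝᵈ`. -/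
abbrev Param (d : ℕ) := EuclideanSpace ℝ (Fin d)

/-- The global objective function, the average of the local ones. -/
noncomputable def globalObj {m d : ℕ} (F : Fin m → Param d → ℝ) (x : Param d) : ℝ :=
  1 / (m : ℝ) * ∑ i, F i x

/-- `g` is a stochastic gradient oracle for the local objectives `F i`, when the mini-batch of
agent `i` has law `D i`. -/
structure IsStochasticGradient {m d : ℕ} {S : Type*} [MeasurableSpace S]
    (F : Fin m → Param d → ℝ) (D : Fin m → Measure S) (g : Param d → S → Param d) : Prop where
  differentiable : ∀ i, Differentiable ℝ (F i)
  prob : ∀ i, IsProbabilityMeasure (D i)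
  measurable : Measurable (Function.uncurry g)
  integrable : ∀ i x, Integrable (g x) (D i)
  unbiased : ∀ i x, ∫ s, g x s ∂(D i) = gradient (F i) x

/-- The assumptions on the learning task: (1) `l`-Lipschitz smoothness of the local objectives,
(2) bounded noise, and (3) bounded diversity. -/
structure LearningAssumptions {m d : ℕ} {S : Type*} [MeasurableSpace S]
    (F : Fin m → Param d → ℝ) (D : Fin m → Measure S) (g : Param d → S → Param d)
    (l σ M₁ ζ M₂ : ℝ) : Prop where
  smooth : ∀ i x x', ‖gradient (F i) x - gradient (F i) x'‖ ≤ l * ‖x - x'‖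
  noise_integrable : ∀ i x, Integrable (fun s => ‖g x s - gradient (F i) x‖ ^ 2) (D i)
  noise : ∀ x : Fin m → Param d,
    1 / (m : ℝ) * ∑ i, ∫ s, ‖g (x i) s - gradient (F i) (x i)‖ ^ 2 ∂(D i) ≤
      σ ^ 2 + M₁ / (m : ℝ) * ∑ i, ‖gradient (globalObj F) (x i)‖ ^ 2
  diversity : ∀ x : Param d,
    1 / (m : ℝ) * ∑ i, ‖gradient (F i) x‖ ^ 2 ≤ ζ ^ 2 + M₂ * ‖gradient (globalObj F) x‖ ^ 2

/-- The mini-batches `ξ k i` (iteration `k`, agent `i`) are independent over all iterations and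
agents, and those of agent `i` have law `D i`. -/
structure IsMiniBatchProcess {m : ℕ} {S Ω : Type*} [MeasurableSpace S] [MeasurableSpace Ω]
    (D : Fin m → Measure S) (P : Measure Ω) (ξ : ℕ → Fin m → Ω → S) : Prop where
  measurable : ∀ k i, Measurable (ξ k i)
  law : ∀ k i, Measure.map (ξ k i) P = D i
  indep : iIndepFun (fun q : ℕ × Fin m => ξ q.1 q.2) P

/-- D-PSGD with mixing matrix `W`, learning rate `η`, and common initial parameter vector `x₁`.
`dpsgd … k i` is the parameter vector of agent `i` after `k` iterations. -/
noncomputable def dpsgd {m d : ℕ} {S Ω : Type*} (W : Matrix (Fin m) (Fin m) ℝ) (η : ℝ)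
    (g : Param d → S → Param d) (ξ : ℕ → Fin m → Ω → S) (x₁ : Param d) :
    ℕ → Fin m → Ω → Param d
  | 0 => fun _ _ => x₁
  | k + 1 => fun i ω =>
      ∑ j, W i j • dpsgd W η g ξ x₁ k j ω - η • g (dpsgd W η g ξ x₁ k i ω) (ξ k i ω)

/-- The average over the agents. -/
noncomputable def agentMean {m d : ℕ} {Ω : Type*} (x : Fin m → Ω → Param d) (ω : Ω) : Param d :=
  (1 / (m : ℝ)) • ∑ i, x i ω

/-- `ε`-convergence of the process `x` at `K`: the average of `𝔼 ‖∇F(x̄)‖²` over the first `K`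
parameter vectors (the initial one and those after `1, …, K - 1` iterations) is at most `ε`. -/
def EpsConverged {m d : ℕ} {Ω : Type*} [MeasurableSpace Ω] (P : Measure Ω)
    (F : Fin m → Param d → ℝ) (x : ℕ → Fin m → Ω → Param d) (ε : ℝ) (K : ℕ) : Prop :=
  (∀ k < K, Integrable (fun ω => ‖gradient (globalObj F) (agentMean (x k) ω)‖ ^ 2) P) ∧
  1 / (K : ℝ) * ∑ k ∈ Finset.range K,
    ∫ ω, ‖gradient (globalObj F) (agentMean (x k) ω)‖ ^ 2 ∂P ≤ ε

/-- The iteration bound `K(p, t)`; `c` is the constant implied by the `O(·)`, and `gap` is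
the initial optimality gap `F(x̄⁽¹⁾) - F_inf`. -/
noncomputable def iterBound (c : ℝ) (m : ℕ) (l gap σ ζ M₁ M₂ ε p : ℝ) (t : ℕ) : ℝ :=
  l * gap * (c * (σ ^ 2 / (m * ε ^ 2) +
    (ζ * t * √(M₁ + 1) + σ * √(p * t)) / (p * ε ^ (3 / 2 : ℝ)) +
    t * √((M₂ + 1) * (M₁ + 1)) / (p * ε)))

/-- `K̄(E_a) = K(1 - ρ̄², 1)`. -/
noncomputable def KBar (c : ℝ) {m : ℕ} (G A : SimpleGraph (Fin m)) (α₀ : G.edgeSet → ℝ)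
    (l gap σ ζ M₁ M₂ ε : ℝ) : ℝ :=
  iterBound c m l gap σ ζ M₁ M₂ ε (1 - rhoBar G A α₀ ^ 2) 1

/-! The time bound is a product of two independent estimates: one for the iteration time and one for
the number of iterations.

Schedule. For an underlay link `e`, let `F` be the set of overlay links routed through `e`. Then `e`
belongs to the category of `F`, so the inferred constraint for `F` already bounds the load on `e`;
hence feasibility for the true underlay. For the iteration time, any `t` admissible in `tauBar`
yields a one-hop schedule with rates `size h / t`: these are below the rates tested in `tauBar`, and
a flow finishes within `t` plus one delay, hence within `2 * t`. So `τ ≤ 2 * tauBar`, and the lost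
factor two is paid for by performing only half of `KBar` iterations.

Mixing. The restricted predetermined weights are feasible for the link weight SDP with value
`rhoBar`, so the optimal weights do at least as well. With `p = 1 - rhoBar ^ 2`, mixing multiplies
the consensus error by at most `1 - p` (`IsOptimalWeights.sum_norm_sq_le`).

Learning. The Lyapunov function is the optimality gap of the mean plus `4 * η * l ^ 2 / p` times the
average consensus error. The descent lemma makes the gap decrease along the mean, up to an error
from disagreement; the contraction of the consensus error absorbs that error. The resulting expected
drop `η / 8 * ‖∇F‖ ^ 2`, up to a constant `R`, is `lyapunov_dpsgdStep`. Since fresh mini-batches are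
independent of the current state, `lyapunov_sum_le` telescopes the drops. Finally
`exists_learning_rate` picks `η` so that `R ≤ η * ε / 16` and `gap / (η * ε)` is a fixed fraction of
the iteration bound. -/

/-! ### The communication schedule -/

section Scheduling

variable {m : ℕ} {Node Link : Type*} {U : Underlay Node Link} {O : Overlay m U}

/-- A schedule that meets the inferred capacity constraint is feasible over the true underlay. -/
theorem Schedule.RespectsInferred.respectsUnderlay {T : Tomography O} {A : SimpleGraph (Fin m)}
    {s : Schedule m} (hs : s.RespectsInferred T A)
    (hdet : ∀ F ∈ O.nonemptyCategories, F.Nonempty → F ∈ T.detected)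
    (hcap : ∀ F ∈ O.nonemptyCategories, F.Nonempty → T.cap F ≤ O.categoryCap F) :
    s.RespectsUnderlay O A := by
  classical
  intro e
  set F := O.links.filter (fun q => e ∈ O.route q.1 q.2) with hF
  rcases F.eq_empty_or_nonempty with h0 | hne
  · have : ∑ q ∈ F, ∑ h ∈ flowSources A, s.f h q.1 q.2 ≤ U.cap e := by
      rw [h0, Finset.sum_empty]; exact (U.cap_pos e).le
    convert this
  -- `F` collects all overlay links through `e`, so "by and only by" holds for `e` by construction.
  · have he : e ∈ O.category F := by
      refine ⟨fun q hq => (Finset.mem_filter.1 hq).2, fun q hq hqF hmem => hqF ?_⟩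
      exact Finset.mem_filter.2 ⟨hq, hmem⟩
    have hmem : F ∈ O.nonemptyCategories := ⟨Finset.filter_subset _ _, ⟨e, he⟩⟩
    have h1 := hs F (hdet F hmem hne)
    have h2 : O.categoryCap F ≤ U.cap e := by
      refine csInf_le ⟨0, ?_⟩ ⟨e, he, rfl⟩
      rintro _ ⟨e', _, rfl⟩
      exact (U.cap_pos e').le
    have := (h1.trans (hcap F hmem hne)).trans h2
    convert this

open Classical in
/-- Direct transmission: the flow from `h` is sent at rate `d h` over every activated link
leaving `h`. -/
noncomputable def directSchedule (A : SimpleGraph (Fin m)) (d : Fin m → ℝ) : Schedule m where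
  z h i j := if i = h ∧ A.Adj h j then 1 else 0
  r h k i j := if i = h ∧ j = k then 1 else 0
  d := d
  f h i j := if i = h ∧ A.Adj h j then d h else 0

theorem directSchedule_serves {A : SimpleGraph (Fin m)} (hA : A ≤ O.base) {d : Fin m → ℝ}
    {M τ : ℝ} (hd : ∀ h, 0 < d h) (hM : ∀ h ∈ flowSources A, d h ≤ M) (hτ : 0 ≤ τ)
    (htime : ∀ h k, A.Adj h k → O.size h / d h + O.delay h k ≤ τ) :
    (directSchedule A d).Serves O A M τ := by
  classical
  have hlink : ∀ {h k}, A.Adj h k → (h, k) ∈ O.links := fun h =>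
    Finset.mem_filter.2 ⟨Finset.mem_univ _, hA h⟩
  refine ⟨hτ, ?_, ?_, ?_, ?_, ?_, ?_, ?_, ?_, ?_, ?_⟩
  · intro h k hk
    refine ⟨hd h, ?_⟩
    have : ∑ q ∈ O.links, O.delay q.1 q.2 * (directSchedule A d).r h k q.1 q.2 = O.delay h k := by
      rw [Finset.sum_eq_single (h, k)]
      · simp [directSchedule]
      · rintro ⟨i, j⟩ _ hne
        have : ¬ (i = h ∧ j = k) := fun hij => hne (by rw [hij.1, hij.2])
        simp [directSchedule, this]
      · exact fun hn => absurd (hlink hk) hn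
    rw [this]
    exact htime h k hk
  · intro h k hk i
    have h1 : ∑ j ∈ Finset.univ.filter (fun j => (i, j) ∈ O.links),
        (directSchedule A d).r h k i j = if i = h then 1 else 0 := by
      split_ifs with hi
      · subst hi
        rw [Finset.sum_eq_single k]
        · simp [directSchedule]
        · intro j _ hne; simp [directSchedule, hne]
        · intro hn; exact absurd (by simpa using hlink hk) hn
      · exact Finset.sum_eq_zero fun j _ => by simp [directSchedule, hi]
    have h2 : ∑ j ∈ Finset.univ.filter (fun j => (j, i) ∈ O.links),
        (directSchedule A d).r h k j i = if i = k then 1 else 0 := by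
      split_ifs with hi
      · subst hi
        rw [Finset.sum_eq_single h]
        · simp [directSchedule]
        · intro j _ hne; simp [directSchedule, hne]
        · intro hn; exact absurd (by simpa using hlink hk) hn
      · exact Finset.sum_eq_zero fun j _ => by simp [directSchedule, hi]
    have hne : h ≠ k := hk.ne
    have h3 : (if i = h then (1 : ℝ) else 0) = (if i = k then 1 else 0) +
        (if i = h then 1 else if i = k then -1 else 0) := by
      by_cases hi : i = h
      · have : i ≠ k := fun h' => hne (hi ▸ h')
        simp [hi, hne]
      · by_cases hik : i = k <;> simp [hi, hik, hne.symm]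
    rw [← h1, ← h2] at h3
    convert h3
  · rintro h k hk ⟨i, j⟩ _
    by_cases hij : i = h ∧ j = k
    · obtain ⟨rfl, rfl⟩ := hij
      simp [directSchedule, hk]
    · simp only [directSchedule, if_neg hij]
      split_ifs <;> norm_num
  · rintro h hh ⟨i, j⟩ _
    by_cases hij : i = h ∧ A.Adj h j
    · simp [directSchedule, hij]
    · simpa [directSchedule, hij] using hM h hh
  · rintro h _ ⟨i, j⟩ _
    by_cases hij : i = h ∧ A.Adj h j
    · simp [directSchedule, hij]
    · simpa [directSchedule, hij] using (hd h).le
  · rintro h hh ⟨i, j⟩ _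
    by_cases hij : i = h ∧ A.Adj h j
    · simpa [directSchedule, hij] using hM h hh
    · simp [directSchedule, hij]
  · rintro h k _ ⟨i, j⟩ _
    by_cases hij : i = h ∧ j = k <;> simp [directSchedule, hij]
  · rintro h _ ⟨i, j⟩ _
    by_cases hij : i = h ∧ A.Adj h j <;> simp [directSchedule, hij]
  · intro h hh
    exact ⟨(hd h).le, hM h hh⟩
  · rintro h _ ⟨i, j⟩ _
    by_cases hij : i = h ∧ A.Adj h j
    · simpa [directSchedule, hij] using (hd h).le
    · simp [directSchedule, hij]

-- Only the flow whose source is `i` uses a link `(i, j)`, so the sum over flows has at most one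
-- nonzero term.
open Classical in
theorem directSchedule_load (A : SimpleGraph (Fin m)) (d : Fin m → ℝ)
    (F : Finset (Fin m × Fin m)) :
    ∑ q ∈ F, ∑ h ∈ flowSources A, (directSchedule A d).f h q.1 q.2 =
      ∑ q ∈ F.filter (fun q => A.Adj q.1 q.2), d q.1 := by
  rw [Finset.sum_filter]
  refine Finset.sum_congr rfl ?_
  rintro ⟨i, j⟩ _
  split_ifs with hij
  · rw [Finset.sum_eq_single i]
    · simp [directSchedule, hij]
    · intro h _ hne; simp [directSchedule, hne.symm]
    · intro hn
      exact absurd (Finset.mem_filter.2 ⟨Finset.mem_univ _, j, hij⟩) hn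
  · refine Finset.sum_eq_zero fun h _ => ?_
    have : ¬ (i = h ∧ A.Adj h j) := by rintro ⟨rfl, h'⟩; exact hij h'
    simp [directSchedule, this]

open Classical in
/-- The set of times whose infimum is `tauBar`. -/
def directTimes (T : Tomography O) (A : SimpleGraph (Fin m)) : Set ℝ :=
  {τ : ℝ | 0 ≤ τ ∧ (∀ i j, A.Adj i j → O.delay i j < τ) ∧
    ∀ F ∈ T.detected, ∑ q ∈ F.filter (fun q => A.Adj q.1 q.2),
      O.size q.1 / (τ - O.delay q.1 q.2) ≤ T.cap F}

/-- All tested rates tend to `0` as `τ → ∞`, while the finitely many inferred capacities are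
positive. Without this, `tauBar` could be the default infimum `0` of the empty set. -/
theorem directTimes_nonempty (T : Tomography O) (A : SimpleGraph (Fin m)) :
    (directTimes T A).Nonempty := by
  classical
  have hlim : ∀ a b : ℝ, Filter.Tendsto (fun τ : ℝ => a / (τ - b)) Filter.atTop (nhds 0) :=
    fun a b => (tendsto_const_nhds (x := a)).div_atTop
      (Filter.tendsto_atTop_add_const_right _ (-b) Filter.tendsto_id)
  have h3 : ∀ F ∈ T.detected, ∀ᶠ τ : ℝ in Filter.atTop,
      ∑ q ∈ F.filter (fun q => A.Adj q.1 q.2), O.size q.1 / (τ - O.delay q.1 q.2) ≤ T.cap F := by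
    intro F hF
    have ht : Filter.Tendsto (fun τ : ℝ => ∑ q ∈ F.filter (fun q => A.Adj q.1 q.2),
        O.size q.1 / (τ - O.delay q.1 q.2)) Filter.atTop (nhds 0) := by
      simpa using tendsto_finsetSum (F.filter fun q => A.Adj q.1 q.2)
        fun q _ => hlim (O.size q.1) (O.delay q.1 q.2)
    exact (ht.eventually_lt_const (T.cap_pos F hF)).mono fun _ h => h.le
  have h2 : ∀ᶠ τ : ℝ in Filter.atTop, ∀ i j, O.delay i j < τ :=
    Filter.eventually_all.2 fun i => Filter.eventually_all.2 fun j =>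
      Filter.eventually_gt_atTop _
  obtain ⟨τ, hτ0, hτ2, hτ3⟩ := ((Filter.eventually_ge_atTop (0 : ℝ)).and
    (h2.and ((Filter.eventually_all_finset _).2 h3))).exists
  exact ⟨τ, hτ0, fun i j _ => hτ2 i j, fun F hF => by convert hτ3 F hF⟩

/-- The flow from an agent has the same rate on every link of its multicast tree, while the
direct transmission behind `tauBar` adapts the rate to the delay of each link. This costs at most
a factor two. -/
theorem Schedule.IsOptimal.le_two_mul_tauBar {T : Tomography O} {A : SimpleGraph (Fin m)}
    (hA : A ≤ O.base) {M τ : ℝ} (hM : IsRateBound T A M) {s : Schedule m}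
    (hs : s.IsOptimal T A M τ) : τ ≤ 2 * tauBar T A := by
  classical
  have key : ∀ t ∈ directTimes T A, τ / 2 ≤ t := by
    rintro t ⟨ht0, htd, htF⟩
    set d : Fin m → ℝ := fun h => if 0 < t then O.size h / t else 1 with hd
    have hdpos : ∀ h, 0 < d h := by
      intro h
      simp only [hd]
      split_ifs with ht
      · exact div_pos (O.size_pos h) ht
      · exact one_pos
    have hpos : ∀ {i j}, A.Adj i j → 0 < t := fun {i j} hij =>
      (O.delay_nonneg i j).trans_lt (htd i j hij)
    have hinf : (directSchedule A d).RespectsInferred T A := by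
      intro F hF
      rw [directSchedule_load]
      refine le_trans (Finset.sum_le_sum fun q hq => ?_) (htF F hF)
      have hq' := (Finset.mem_filter.1 hq).2
      have ht := hpos hq'
      simp only [hd, if_pos ht]
      exact div_le_div_of_nonneg_left (O.size_pos _).le (sub_pos.2 (htd _ _ hq'))
        (sub_le_self _ (O.delay_nonneg _ _))
    have htime : ∀ h k, A.Adj h k → O.size h / d h + O.delay h k ≤ 2 * t := by
      intro h k hk
      have ht := hpos hk
      have h1 : O.size h / d h = t := by
        simp only [hd, if_pos ht]
        exact div_div_cancel₀ (O.size_pos h).ne'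
      rw [h1, two_mul]
      exact add_le_add_right (htd h k hk).le t
    -- The schedule is first feasible with the generous big-M constant `∑ h, d h`; the rate bound
    -- then gives `d h ≤ M`, which makes it feasible for the actual `M`.
    have hbound : ∀ h ∈ flowSources A, d h ≤ M :=
      hM (∑ h, d h) (2 * t) (directSchedule A d)
        ⟨directSchedule_serves hA hdpos (fun h _ => Finset.single_le_sum
          (fun i _ => (hdpos i).le) (Finset.mem_univ h)) (by linarith) htime, hinf⟩
    have := hs.2 _ _ ⟨directSchedule_serves hA hdpos hbound (by linarith) htime, hinf⟩
    linarith
  have := le_csInf (directTimes_nonempty T A) key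
  have h2 : sInf (directTimes T A) = tauBar T A := rfl
  linarith

end Scheduling

/-! ### Markov recursions with a Lyapunov function -/

section Recursion

variable {Ω E S : Type*} [MeasurableSpace Ω] [MeasurableSpace E] [MeasurableSpace S]
  {P : Measure Ω} [IsProbabilityMeasure P]

/-- If the expected value of `Φ ≥ 0` drops by at least `a * e - R` in each step, then the
expectations of `e` along the recursion are finite and their sum is controlled. -/
theorem lyapunov_sum_le {π : Measure S} [IsProbabilityMeasure π]
    {X : ℕ → Ω → E} {ξ : ℕ → Ω → S} {step : E → S → E}
    (hX : ∀ k, Measurable (X k)) (hξ : ∀ k, Measurable (ξ k))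
    (hstep : Measurable (Function.uncurry step))
    (hrec : ∀ k ω, X (k + 1) ω = step (X k ω) (ξ k ω))
    (hlaw : ∀ k, P.map (fun ω => (X k ω, ξ k ω)) = (P.map (X k)).prod π)
    {Φ e : E → ℝ} (hΦm : Measurable Φ) (hem : Measurable e) (hΦ : ∀ x, 0 ≤ Φ x)
    (he : ∀ x, 0 ≤ e x) {a R c₀ : ℝ} (ha : 0 < a)
    (hint : ∀ x, Integrable (fun s => Φ (step x s)) π)
    (hdrop : ∀ x, ∫ s, Φ (step x s) ∂π ≤ Φ x - a * e x + R) (h0 : ∀ ω, Φ (X 0 ω) = c₀) :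
    (∀ k, Integrable (fun ω => e (X k ω)) P) ∧
      ∀ K : ℕ, a * ∑ k ∈ Finset.range K, ∫ ω, e (X k ω) ∂P ≤ c₀ + K * R := by
  -- The expected next value of `Φ` is nonnegative, so the drop inequality gives the pointwise
  -- domination `a * e ≤ Φ + R`.
  have heint : ∀ k, Integrable (fun ω => Φ (X k ω)) P → Integrable (fun ω => e (X k ω)) P := by
    intro k hk
    refine Integrable.mono' ((hk.add (integrable_const R)).const_mul a⁻¹)
      (hem.comp (hX k)).aestronglyMeasurable (Filter.Eventually.of_forall fun ω => ?_)
    rw [Real.norm_of_nonneg (he _)]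
    have h1 : 0 ≤ ∫ s, Φ (step (X k ω) s) ∂π := integral_nonneg fun s => hΦ _
    have h2 := hdrop (X k ω)
    simp only [Pi.add_apply]
    rw [inv_mul_eq_div, le_div_iff₀ ha]
    linarith
  have hnext : ∀ k, Integrable (fun ω => Φ (X k ω)) P →
      Integrable (fun ω => Φ (X (k + 1) ω)) P ∧
        ∫ ω, Φ (X (k + 1) ω) ∂P ≤
          ∫ ω, Φ (X k ω) ∂P - a * ∫ ω, e (X k ω) ∂P + R := by
    intro k hk
    have : IsProbabilityMeasure (P.map (X k)) :=
      Measure.isProbabilityMeasure_map (hX k).aemeasurable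
    have hpair : Measurable fun ω => (X k ω, ξ k ω) := (hX k).prodMk (hξ k)
    have hm : Measurable fun q : E × S => Φ (step q.1 q.2) := hΦm.comp hstep
    have hek := heint k hk
    have hkE : Integrable Φ (P.map (X k)) :=
      (integrable_map_measure hΦm.aestronglyMeasurable (hX k).aemeasurable).2 hk
    have heE : Integrable e (P.map (X k)) :=
      (integrable_map_measure hem.aestronglyMeasurable (hX k).aemeasurable).2 hek
    have hmI : AEStronglyMeasurable (fun x => ∫ s, Φ (step x s) ∂π) (P.map (X k)) :=
      (hm.stronglyMeasurable.integral_prod_right').aestronglyMeasurable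
    have hI : Integrable (fun x => ∫ s, Φ (step x s) ∂π) (P.map (X k)) := by
      refine Integrable.mono' (hkE.add (integrable_const R)) hmI
        (Filter.Eventually.of_forall fun x => ?_)
      rw [Real.norm_of_nonneg (integral_nonneg fun s => hΦ _)]
      have := hdrop x
      have := mul_nonneg ha.le (he x)
      simp only [Pi.add_apply]
      linarith
    -- Fibrewise integrability suffices here: as `Φ ≥ 0`, the integral of the norm over a fibre is
    -- the conditional expectation, dominated by `Φ + R`.
    have hprod : Integrable (fun q : E × S => Φ (step q.1 q.2)) ((P.map (X k)).prod π) := by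
      refine (integrable_prod_iff hm.aestronglyMeasurable).2
        ⟨Filter.Eventually.of_forall hint, ?_⟩
      simpa only [Real.norm_of_nonneg (hΦ _)] using hI
    have hprod' := hprod
    rw [← hlaw k, integrable_map_measure hm.aestronglyMeasurable hpair.aemeasurable] at hprod'
    simp only [hrec]
    refine ⟨hprod', ?_⟩
    have h1 : ∫ ω, Φ (step (X k ω) (ξ k ω)) ∂P =
        ∫ x, ∫ s, Φ (step x s) ∂π ∂(P.map (X k)) := by
      rw [← integral_prod _ hprod, ← hlaw k,
        integral_map hpair.aemeasurable hm.aestronglyMeasurable]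
    rw [h1]
    calc ∫ x, ∫ s, Φ (step x s) ∂π ∂(P.map (X k))
        ≤ ∫ x, (Φ x - a * e x + R) ∂(P.map (X k)) :=
          integral_mono hI ((hkE.sub (heE.const_mul a)).add (integrable_const R)) hdrop
      _ = ∫ x, Φ x ∂(P.map (X k)) - a * ∫ x, e x ∂(P.map (X k)) + R := by
          rw [integral_add (f := fun x => Φ x - a * e x) (hkE.sub (heE.const_mul a))
              (integrable_const R),
            integral_sub hkE (heE.const_mul a), integral_const_mul]
          simp
      _ = _ := by
          rw [integral_map (hX k).aemeasurable hΦm.aestronglyMeasurable,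
            integral_map (hX k).aemeasurable hem.aestronglyMeasurable]
  have hΦint : ∀ k, Integrable (fun ω => Φ (X k ω)) P := by
    intro k
    induction k with
    | zero => simpa only [h0] using integrable_const c₀
    | succ k ih => exact (hnext k ih).1
  refine ⟨fun k => heint k (hΦint k), fun K => ?_⟩
  have : ∫ ω, Φ (X K ω) ∂P + a * ∑ k ∈ Finset.range K, ∫ ω, e (X k ω) ∂P ≤ c₀ + K * R := by
    induction K with
    | zero => simp [h0]
    | succ K ih =>
      rw [Finset.sum_range_succ]
      have := (hnext K (hΦint K)).2
      push_cast
      linarith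
  have h1 : 0 ≤ ∫ ω, Φ (X K ω) ∂P := integral_nonneg fun ω => hΦ _
  linarith

/-- The state of a recursion driven by independent noise is independent of the next noise. -/
theorem map_state_noise_eq_prod {ι : Type*} [Fintype ι] {D : ι → Measure S}
    {ξ : ℕ → ι → Ω → S} (hξ : ∀ k i, Measurable (ξ k i))
    (hlaw : ∀ k i, P.map (ξ k i) = D i)
    (hind : iIndepFun (fun q : ℕ × ι => ξ q.1 q.2) P)
    {X : ℕ → Ω → E} {step : E → (ι → S) → E} (hstep : Measurable (Function.uncurry step))
    (x₁ : E) (h0 : ∀ ω, X 0 ω = x₁)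
    (hrec : ∀ k ω, X (k + 1) ω = step (X k ω) (fun i => ξ k i ω)) (k : ℕ) :
    Measurable (X k) ∧
      P.map (fun ω => (X k ω, fun i => ξ k i ω)) = (P.map (X k)).prod (Measure.pi D) := by
  set 𝓕 : ℕ × ι → MeasurableSpace Ω := fun q =>
    MeasurableSpace.comap (ξ q.1 q.2) inferInstance with h𝓕
  have hle : ∀ q, 𝓕 q ≤ ‹MeasurableSpace Ω› := fun q => (hξ q.1 q.2).comap_le
  have hnoise : ∀ (k : ℕ) (T : Set (ℕ × ι)), (∀ i, (k, i) ∈ T) →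
      Measurable[⨆ q ∈ T, 𝓕 q] (fun ω i => ξ k i ω) := by
    intro k T hT
    refine @measurable_pi_lambda _ _ _ (⨆ q ∈ T, 𝓕 q) _ _ fun i => ?_
    refine Measurable.mono (comap_measurable (ξ k i)) ?_ le_rfl
    exact le_iSup₂_of_le (k, i) (hT i) le_rfl
  -- The state after `k` steps is a function of the noise with index below `k`; it is therefore
  -- independent of the noise with index exactly `k`.
  have hpast : ∀ k, Measurable[⨆ q ∈ {q : ℕ × ι | q.1 < k}, 𝓕 q] (X k) := by
    intro k
    induction k with
    | zero =>
      have : X 0 = fun _ => x₁ := funext h0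
      rw [this]
      exact measurable_const
    | succ k ih =>
      have : X (k + 1) = fun ω => Function.uncurry step (X k ω, fun i => ξ k i ω) :=
        funext fun ω => hrec k ω
      rw [this]
      refine hstep.comp (Measurable.prodMk (ih.mono ?_ le_rfl) (hnoise k _ fun i => ?_))
      · exact biSup_mono fun q (hq : q.1 < k) => Nat.lt_succ_of_lt hq
      · exact Nat.lt_succ_self k
  have hsup : ∀ T : Set (ℕ × ι), (⨆ q ∈ T, 𝓕 q) ≤ ‹MeasurableSpace Ω› := fun T =>
    iSup₂_le fun q _ => hle q
  have hXm : Measurable (X k) := (hpast k).mono (hsup _) le_rfl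
  have hξm : Measurable fun ω i => ξ k i ω := measurable_pi_lambda _ fun i => hξ k i
  refine ⟨hXm, ?_⟩
  have hIndep : IndepFun (X k) (fun ω i => ξ k i ω) P := by
    have h1 := indep_iSup_of_disjoint hle hind.iIndep
      (S := {q : ℕ × ι | q.1 < k}) (T := {q : ℕ × ι | q.1 = k})
      (Set.disjoint_left.2 fun q (h1 : q.1 < k) (h2 : q.1 = k) => h1.ne h2)
    exact indep_of_indep_of_le_left (indep_of_indep_of_le_right h1
      (hnoise k {q : ℕ × ι | q.1 = k} fun _ => rfl).comap_le) (hpast k).comap_le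
  rw [(indepFun_iff_map_prod_eq_prod_map_map hXm.aemeasurable hξm.aemeasurable).1 hIndep]
  congr 1
  have hinj : Function.Injective fun i : ι => (k, i) := fun i j h => (Prod.mk.inj h).2
  have h2 : iIndepFun (fun i => ξ k i) P := iIndepFun.precomp (g := fun i : ι => (k, i)) hinj hind
  rw [(iIndepFun_iff_map_fun_eq_pi_map fun i => (hξ k i).aemeasurable).1 h2]
  simp only [hlaw]

end Recursion

/-! ### Independent centred noise -/

section Noise

variable {ι S : Type*} [Fintype ι] [MeasurableSpace S] {D : ι → Measure S}
  [∀ i, IsProbabilityMeasure (D i)] {d : ℕ}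

/-- Cross terms between independent centred vectors vanish. Coordinate by coordinate, this is
additivity of the variance on a product space. -/
theorem integral_norm_sum_sq_pi {n : ι → S → Param d} (hn : ∀ i, MemLp (n i) 2 (D i))
    (h0 : ∀ i, ∫ s, n i s ∂(D i) = 0) :
    ∫ s, ‖∑ i, n i (s i)‖ ^ 2 ∂(Measure.pi D) = ∑ i, ∫ s, ‖n i s‖ ^ 2 ∂(D i) := by
  have hc : ∀ i c, MemLp (fun s => n i s c) 2 (D i) := fun i c =>
    (EuclideanSpace.proj (𝕜 := ℝ) c).comp_memLp' (hn i)
  have hc0 : ∀ i c, ∫ s, n i s c ∂(D i) = 0 := by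
    intro i c
    have := (EuclideanSpace.proj (𝕜 := ℝ) c).integral_comp_comm
      ((hn i).integrable one_le_two)
    rw [h0 i] at this
    simpa using this
  have hpi : ∀ i c, MemLp (fun s : ι → S => n i (s i) c) 2 (Measure.pi D) := fun i c =>
    (hc i c).comp_measurePreserving (measurePreserving_eval D i)
  have hcoord : ∀ c, ∫ s, (∑ i, n i (s i) c) ^ 2 ∂(Measure.pi D) =
      ∑ i, ∫ s, (n i s c) ^ 2 ∂(D i) := by
    intro c
    have h1 := variance_sum_pi (μ := D) (X := fun i s => n i s c) fun i => hc i c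
    have hz : ∫ s, (∑ i, fun s : ι → S => n i (s i) c) s ∂(Measure.pi D) = 0 := by
      simp only [Finset.sum_apply]
      rw [integral_finsetSum _ fun i _ => (hpi i c).integrable one_le_two]
      refine Finset.sum_eq_zero fun i _ => ?_
      rw [integral_comp_eval (μ := D) (f := fun s => n i s c) (hc i c).aestronglyMeasurable]
      exact hc0 i c
    rw [variance_of_integral_eq_zero (memLp_finsetSum' _ fun i _ => hpi i c).aemeasurable hz] at h1
    simp only [variance_of_integral_eq_zero (hc _ c).aemeasurable (hc0 _ c),
      Finset.sum_apply] at h1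
    exact h1
  simp only [EuclideanSpace.real_norm_sq_eq, WithLp.ofLp_sum, Finset.sum_apply]
  rw [integral_finsetSum]
  · simp only [hcoord]
    rw [Finset.sum_comm]
    refine Finset.sum_congr rfl fun i _ => ?_
    rw [integral_finsetSum _ fun c _ => (hc i c).integrable_sq]
  · intro c _
    exact (memLp_finsetSum _ fun i _ => hpi i c).integrable_sq

end Noise

/-! ### Mixing matrices -/

section Mixing

variable {m : ℕ}

theorem orientedInc_col_sum (G : SimpleGraph (Fin m)) (e : G.edgeSet) :
    ∑ i, orientedInc G i e = 0 := by
  obtain ⟨e, he⟩ := e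
  have hne : e.inf ≠ e.sup := by
    induction e with
    | h i j =>
      have hij : i ≠ j := G.ne_of_adj he
      simpa [Sym2.inf_mk, Sym2.sup_mk, inf_eq_sup] using hij
  have : ∀ i, orientedInc G i ⟨e, he⟩ =
      (if i = e.inf then 1 else 0) - (if i = e.sup then 1 else 0) := by
    intro i
    simp only [orientedInc, Matrix.of_apply]
    by_cases h1 : i = e.inf
    · simp [h1, hne]
    · simp only [h1, if_false]
      split_ifs <;> norm_num
  simp [this]

theorem weightedLap_isSymm (G : SimpleGraph (Fin m)) (α : G.edgeSet → ℝ) :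
    (weightedLap G α)ᵀ = weightedLap G α := by
  simp [weightedLap, Matrix.transpose_mul, Matrix.mul_assoc]

theorem weightedLap_col_sum (G : SimpleGraph (Fin m)) (α : G.edgeSet → ℝ) (j : Fin m) :
    ∑ i, weightedLap G α i j = 0 := by
  classical
  have h : ∀ i, weightedLap G α i j =
      ∑ e, (orientedInc G * Matrix.diagonal α) i e * orientedInc G j e := fun i => by
    rw [weightedLap, Matrix.mul_apply]; rfl
  simp only [h]
  rw [Finset.sum_comm]
  refine Finset.sum_eq_zero fun e _ => ?_
  simp only [Matrix.mul_diagonal, ← Finset.sum_mul, orientedInc_col_sum, zero_mul]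

theorem mixingMatrix_isSymm (G : SimpleGraph (Fin m)) (α : G.edgeSet → ℝ) :
    (mixingMatrix G α)ᵀ = mixingMatrix G α := by
  simp [mixingMatrix, weightedLap_isSymm]

/-- The columns of the incidence matrix sum to zero. Unit column sums make mixing preserve the mean
over the agents; the unit row sums below make it fix consensus states. -/
theorem mixingMatrix_col_sum (G : SimpleGraph (Fin m)) (α : G.edgeSet → ℝ) (j : Fin m) :
    ∑ i, mixingMatrix G α i j = 1 := by
  simp [mixingMatrix, weightedLap_col_sum, Matrix.one_apply]

theorem mixingMatrix_row_sum (G : SimpleGraph (Fin m)) (α : G.edgeSet → ℝ) (i : Fin m) :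
    ∑ j, mixingMatrix G α i j = 1 := by
  rw [← mixingMatrix_col_sum G α i]
  refine Finset.sum_congr rfl fun j _ => ?_
  conv_lhs => rw [← mixingMatrix_isSymm G α]
  rfl

theorem idealMatrix_isSymm : (idealMatrix m)ᵀ = idealMatrix m := by
  ext i j; simp [idealMatrix]

theorem dotProduct_self_nonneg' (v : Fin m → ℝ) : 0 ≤ v ⬝ᵥ v :=
  Finset.sum_nonneg fun i _ => mul_self_nonneg (v i)

theorem abs_dotProduct_mulVec_le (X : Matrix (Fin m) (Fin m) ℝ) (v : Fin m → ℝ) :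
    |v ⬝ᵥ X *ᵥ v| ≤ matSpectralNorm X * (v ⬝ᵥ v) := by
  set x : EuclideanSpace ℝ (Fin m) := WithLp.toLp 2 v
  have h1 : v ⬝ᵥ X *ᵥ v = inner ℝ x (Matrix.toEuclideanCLM (n := Fin m) (𝕜 := ℝ) X x) := by
    simp [x, Matrix.toEuclideanCLM_toLp, EuclideanSpace.inner_eq_star_dotProduct,
      dotProduct_comm]
  have h2 : v ⬝ᵥ v = ‖x‖ * ‖x‖ := by
    rw [← sq, EuclideanSpace.real_norm_sq_eq]
    simp [x, dotProduct, sq]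
  rw [h1, h2]
  calc _ ≤ ‖x‖ * ‖Matrix.toEuclideanCLM (n := Fin m) (𝕜 := ℝ) X x‖ := abs_real_inner_le_norm _ _
    _ ≤ ‖x‖ * (matSpectralNorm X * ‖x‖) := by
        gcongr
        exact ContinuousLinearMap.le_opNorm _ _
    _ = _ := by ring

/-- A symmetric matrix between `-ρ I` and `ρ I` does not expand squared lengths by more than
`ρ²`. -/
theorem mulVec_sq_le {X : Matrix (Fin m) (Fin m) ℝ} (hX : Xᵀ = X) {ρ : ℝ} (hρ : 0 ≤ ρ)
    (h : ∀ v, |v ⬝ᵥ X *ᵥ v| ≤ ρ * (v ⬝ᵥ v)) (v : Fin m → ℝ) :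
    (X *ᵥ v) ⬝ᵥ (X *ᵥ v) ≤ ρ ^ 2 * (v ⬝ᵥ v) := by
  have hsymm : ∀ a b : Fin m → ℝ, a ⬝ᵥ X *ᵥ b = b ⬝ᵥ X *ᵥ a := by
    intro a b
    rw [Matrix.dotProduct_mulVec, ← Matrix.mulVec_transpose, hX, dotProduct_comm]
  set q := (X *ᵥ v) ⬝ᵥ (X *ᵥ v) with hq
  have hqv : v ⬝ᵥ X *ᵥ (X *ᵥ v) = q := by
    rw [hsymm]
  -- Polarization: the form bound at `v + t • X v` minus the one at `v - t • X v` isolates the cross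
  -- term. For `ρ > 0` the best choice is `t = 1 / ρ`; for `ρ = 0` any positive `t` forces `q ≤ 0`.
  have key : ∀ t : ℝ, 2 * t * q ≤ ρ * (v ⬝ᵥ v + t ^ 2 * q) := by
    intro t
    have h1 := (abs_le.1 (h (v + t • X *ᵥ v))).2
    have h2 := (abs_le.1 (h (v - t • X *ᵥ v))).1
    simp only [Matrix.mulVec_add, Matrix.mulVec_sub, Matrix.mulVec_smul, add_dotProduct,
      sub_dotProduct, dotProduct_add, dotProduct_sub, smul_dotProduct, dotProduct_smul,
      smul_eq_mul, hqv, dotProduct_comm (X *ᵥ v) v, ← hq] at h1 h2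
    linarith
  have hv := dotProduct_self_nonneg' v
  rcases hρ.eq_or_lt with h0 | hpos
  · have := key 1
    rw [← h0] at this ⊢
    linarith
  · have := key (1 / ρ)
    have h3 : ρ * (2 * (1 / ρ) * q) ≤ ρ * (ρ * (v ⬝ᵥ v + (1 / ρ) ^ 2 * q)) := by gcongr
    have h4 : ρ * (2 * (1 / ρ) * q) = 2 * q := by field_simp
    have h5 : ρ * (ρ * (v ⬝ᵥ v + (1 / ρ) ^ 2 * q)) = ρ ^ 2 * (v ⬝ᵥ v) + q := by
      field_simp
    linarith

theorem rhoBar_nonneg (G A : SimpleGraph (Fin m)) (α₀ : G.edgeSet → ℝ) : 0 ≤ rhoBar G A α₀ :=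
  norm_nonneg _

theorem dotProduct_smul_one_mulVec (c : ℝ) (v : Fin m → ℝ) :
    v ⬝ᵥ (c • (1 : Matrix (Fin m) (Fin m) ℝ)) *ᵥ v = c * (v ⬝ᵥ v) := by
  rw [Matrix.smul_mulVec, Matrix.one_mulVec, dotProduct_smul, smul_eq_mul]

theorem feasibleWeights_iff {G A : SimpleGraph (Fin m)} {α : G.edgeSet → ℝ} {ρ : ℝ} :
    FeasibleWeights G A α ρ ↔
      (∀ v, |v ⬝ᵥ (mixingMatrix G α - idealMatrix m) *ᵥ v| ≤ ρ * (v ⬝ᵥ v)) ∧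
        ∀ e : G.edgeSet, (e : Sym2 (Fin m)) ∉ A.edgeSet → α e = 0 := by
  have hX : (mixingMatrix G α - idealMatrix m)ᵀ = mixingMatrix G α - idealMatrix m := by
    rw [Matrix.transpose_sub, mixingMatrix_isSymm, idealMatrix_isSymm]
  have h1 : ∀ c : ℝ, (c • (1 : Matrix (Fin m) (Fin m) ℝ))ᵀ = c • 1 := fun c => by simp
  unfold FeasibleWeights
  generalize mixingMatrix G α - idealMatrix m = X at hX
  rw [Matrix.posSemidef_iff_dotProduct_mulVec, Matrix.posSemidef_iff_dotProduct_mulVec]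
  have hH : ∀ Y : Matrix (Fin m) (Fin m) ℝ, Yᵀ = Y → Y.IsHermitian := fun Y hY => by
    rw [Matrix.IsHermitian, Matrix.conjTranspose_eq_transpose_of_trivial, hY]
  have hA := hH (X - (-ρ) • (1 : Matrix (Fin m) (Fin m) ℝ)) (by
    rw [Matrix.transpose_sub, h1, hX])
  have hB := hH (ρ • (1 : Matrix (Fin m) (Fin m) ℝ) - X) (by
    rw [Matrix.transpose_sub, h1, hX])
  simp only [hA, hB, true_and, star_trivial, Matrix.sub_mulVec, dotProduct_sub,
    dotProduct_smul_one_mulVec, abs_le]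
  constructor
  · rintro ⟨ha, hb, hc⟩
    exact ⟨fun v => ⟨by have := @ha v; linarith, by have := @hb v; linarith⟩, hc⟩
  · rintro ⟨hab, hc⟩
    exact ⟨fun v => by have := (hab v).1; linarith, fun v => by have := (hab v).2; linarith, hc⟩

/-- This competitor puts the SDP optimum below `rhoBar`: the spectral norm bounds the quadratic form
by Cauchy–Schwarz. -/
theorem restrictWeights_feasible (G A : SimpleGraph (Fin m)) (α₀ : G.edgeSet → ℝ) :
    FeasibleWeights G A (restrictWeights G A α₀) (rhoBar G A α₀) := by
  refine feasibleWeights_iff.2 ⟨fun v => abs_dotProduct_mulVec_le _ v, fun e he => ?_⟩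
  simp [restrictWeights, he]

/-- The optimized mixing matrix contracts towards the average at least as much as the
predetermined one. -/
theorem IsOptimalWeights.mulVec_sq_le {G A : SimpleGraph (Fin m)} {α : G.edgeSet → ℝ}
    (hα : IsOptimalWeights G A α) (α₀ : G.edgeSet → ℝ) (v : Fin m → ℝ) :
    ((mixingMatrix G α - idealMatrix m) *ᵥ v) ⬝ᵥ ((mixingMatrix G α - idealMatrix m) *ᵥ v) ≤
      rhoBar G A α₀ ^ 2 * (v ⬝ᵥ v) := by
  obtain ⟨ρ, hρ, hmin⟩ := hα
  have hle := hmin _ _ (restrictWeights_feasible G A α₀)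
  have hX : (mixingMatrix G α - idealMatrix m)ᵀ = mixingMatrix G α - idealMatrix m := by
    rw [Matrix.transpose_sub, mixingMatrix_isSymm, idealMatrix_isSymm]
  exact _root_.mulVec_sq_le hX (rhoBar_nonneg _ _ _) (fun w =>
    ((feasibleWeights_iff.1 hρ).1 w).trans
      (mul_le_mul_of_nonneg_right hle (dotProduct_self_nonneg' w))) v

/-- The contraction of the optimized mixing matrix, for vector-valued states of mean zero. -/
theorem IsOptimalWeights.sum_norm_sq_le {G A : SimpleGraph (Fin m)} {α : G.edgeSet → ℝ}
    (hα : IsOptimalWeights G A α) (α₀ : G.edgeSet → ℝ) {d : ℕ} (y : Fin m → Param d)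
    (hy : ∑ i, y i = 0) :
    ∑ i, ‖∑ j, mixingMatrix G α i j • y j‖ ^ 2 ≤ rhoBar G A α₀ ^ 2 * ∑ i, ‖y i‖ ^ 2 := by
  simp only [EuclideanSpace.real_norm_sq_eq, WithLp.ofLp_sum, Finset.sum_apply,
    WithLp.ofLp_smul, Pi.smul_apply, smul_eq_mul]
  rw [Finset.sum_comm, Finset.sum_comm (f := fun i c => (y i c) ^ 2), Finset.mul_sum]
  refine Finset.sum_le_sum fun c _ => ?_
  have hc : ∑ j, y j c = 0 := by
    have := congrArg (fun v : Param d => v c) hy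
    simpa using this
  have h := hα.mulVec_sq_le α₀ (fun j => y j c)
  -- The ideal matrix annihilates vectors of mean zero, so on each coordinate `W - J` acts as `W`.
  have h1 : (mixingMatrix G α - idealMatrix m) *ᵥ (fun j => y j c) =
      fun i => ∑ j, mixingMatrix G α i j * y j c := by
    funext i
    simp only [Matrix.mulVec, dotProduct, Matrix.sub_apply, sub_mul, Finset.sum_sub_distrib,
      idealMatrix, Matrix.of_apply, ← Finset.mul_sum, hc]
    ring
  rw [h1] at h
  simpa only [dotProduct, ← sq] using h

end Mixing

/-! ### Smooth functions -/

section Smooth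

variable {E : Type*} [NormedAddCommGroup E] [InnerProductSpace ℝ E] [CompleteSpace E]

/-- The descent lemma for functions with Lipschitz gradient. -/
theorem le_add_inner_gradient_add_sq {f : E → ℝ} {l : ℝ} (hf : Differentiable ℝ f)
    (hl : ∀ x y, ‖gradient f x - gradient f y‖ ≤ l * ‖x - y‖) (x v : E) :
    f (x + v) ≤ f x + inner ℝ (gradient f x) v + l / 2 * ‖v‖ ^ 2 := by
  -- `φ` is `f` along the segment minus the claimed quadratic majorant, up to the constant `f x`.
  -- The Lipschitz bound makes its derivative nonpositive on `(0, 1)`, and `φ 1 ≤ φ 0` is the claim.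
  set φ : ℝ → ℝ := fun t =>
    f (x + t • v) - t * inner ℝ (gradient f x) v - l / 2 * ‖v‖ ^ 2 * t ^ 2 with hφ
  have hd : ∀ t, HasDerivAt φ (inner ℝ (gradient f (x + t • v)) v -
      inner ℝ (gradient f x) v - l / 2 * ‖v‖ ^ 2 * (2 * t)) t := by
    intro t
    have h1 : HasDerivAt (fun t : ℝ => x + t • v) v t := by
      simpa using ((hasDerivAt_id t).smul_const v).const_add x
    have h2 := (hf (x + t • v)).hasGradientAt.hasFDerivAt.comp_hasDerivAt t h1
    have h3 := (hasDerivAt_id t).mul_const (inner ℝ (gradient f x) v)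
    have h4 := ((hasDerivAt_id t).pow 2).const_mul (l / 2 * ‖v‖ ^ 2)
    refine ((h2.sub h3).sub h4).congr_deriv ?_
    simp
  have hanti : AntitoneOn φ (Set.Icc 0 1) := by
    refine antitoneOn_of_deriv_nonpos (convex_Icc 0 1)
      (fun t _ => (hd t).continuousAt.continuousWithinAt)
      (fun t _ => (hd t).differentiableAt.differentiableWithinAt) fun t ht => ?_
    rw [interior_Icc] at ht
    rw [(hd t).deriv, ← inner_sub_left]
    have h1 := real_inner_le_norm (gradient f (x + t • v) - gradient f x) v
    have h2 := hl (x + t • v) x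
    rw [add_sub_cancel_left, norm_smul, Real.norm_of_nonneg ht.1.le] at h2
    have h3 := mul_le_mul_of_nonneg_right h2 (norm_nonneg v)
    nlinarith
  have := hanti (Set.left_mem_Icc.2 zero_le_one) (Set.right_mem_Icc.2 zero_le_one) zero_le_one
  simp only [hφ, one_smul, zero_smul, add_zero] at this
  linarith

theorem continuous_gradient_of_lipschitz {f : E → ℝ} {l : ℝ}
    (hl : ∀ x y, ‖gradient f x - gradient f y‖ ≤ l * ‖x - y‖) : Continuous (gradient f) := by
  refine (LipschitzWith.of_dist_le_mul (K := l.toNNReal) fun x y => ?_).continuous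
  rw [dist_eq_norm, dist_eq_norm]
  exact (hl x y).trans (by gcongr; exact Real.le_coe_toNNReal l)

end Smooth

theorem globalObj_hasGradientAt {m d : ℕ} {F : Fin m → Param d → ℝ}
    (hF : ∀ i, Differentiable ℝ (F i)) (x : Param d) :
    HasGradientAt (globalObj F) ((1 / (m : ℝ)) • ∑ i, gradient (F i) x) x := by
  rw [hasGradientAt_iff_hasFDerivAt, map_smul, map_sum]
  exact (HasFDerivAt.fun_sum fun i _ => ((hF i) x).hasGradientAt.hasFDerivAt).const_mul _

/-! ### Averages over the agents -/

section Average

variable {m d : ℕ}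

/-- The average of the parameter vectors of the agents. -/
noncomputable def paramMean (x : Fin m → Param d) : Param d := (1 / (m : ℝ)) • ∑ i, x i

/-- The consensus error: the sum of the squared distances from the average. -/
noncomputable def consensusError (x : Fin m → Param d) : ℝ := ∑ i, ‖x i - paramMean x‖ ^ 2

theorem consensusError_nonneg (x : Fin m → Param d) : 0 ≤ consensusError x :=
  Finset.sum_nonneg fun _ _ => sq_nonneg _

theorem natCast_smul_paramMean (hm : 0 < m) (x : Fin m → Param d) :
    (m : ℝ) • paramMean x = ∑ i, x i := by
  have : (m : ℝ) ≠ 0 := by positivity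
  rw [paramMean, smul_smul, mul_one_div_cancel this, one_smul]

theorem sum_sub_paramMean (hm : 0 < m) (x : Fin m → Param d) :
    ∑ i, (x i - paramMean x) = 0 := by
  rw [Finset.sum_sub_distrib, ← natCast_smul_paramMean hm]
  simp [Nat.cast_smul_eq_nsmul]

theorem paramMean_sub (x y : Fin m → Param d) :
    paramMean (fun i => x i - y i) = paramMean x - paramMean y := by
  simp only [paramMean, Finset.sum_sub_distrib, smul_sub]

theorem paramMean_smul (c : ℝ) (x : Fin m → Param d) :
    paramMean (fun i => c • x i) = c • paramMean x := by
  simp only [paramMean, ← Finset.smul_sum, smul_comm c]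

/-- Expanding around the mean, the cross term vanishes because deviations sum to zero. -/
theorem sum_norm_sq_eq (hm : 0 < m) (x : Fin m → Param d) :
    ∑ i, ‖x i‖ ^ 2 = consensusError x + m * ‖paramMean x‖ ^ 2 := by
  have h : ∀ i, ‖x i‖ ^ 2 = ‖x i - paramMean x‖ ^ 2 +
      2 * inner ℝ (x i - paramMean x) (paramMean x) + ‖paramMean x‖ ^ 2 := fun i => by
    rw [← norm_add_sq_real, sub_add_cancel]
  simp only [h, Finset.sum_add_distrib, ← Finset.mul_sum, ← sum_inner, sum_sub_paramMean hm,
    inner_zero_left, consensusError]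
  simp

theorem consensusError_le (hm : 0 < m) (x : Fin m → Param d) :
    consensusError x ≤ ∑ i, ‖x i‖ ^ 2 := by
  rw [sum_norm_sq_eq hm]
  have : 0 ≤ (m : ℝ) * ‖paramMean x‖ ^ 2 := by positivity
  linarith

theorem norm_paramMean_sq_le (hm : 0 < m) (x : Fin m → Param d) :
    ‖paramMean x‖ ^ 2 ≤ 1 / (m : ℝ) * ∑ i, ‖x i‖ ^ 2 := by
  have hm' : (0 : ℝ) < m := by exact_mod_cast hm
  rw [sum_norm_sq_eq hm, one_div, inv_mul_eq_div, le_div_iff₀ hm']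
  linarith [consensusError_nonneg x]

/-- Young's inequality with a free weight: a small `t` preserves a contraction in `a`, while `t = 1`
gives the plain factor two. -/
theorem sum_norm_sub_sq_le {t : ℝ} (ht : 0 < t) (a b : Fin m → Param d) :
    ∑ i, ‖a i - b i‖ ^ 2 ≤ (1 + t) * ∑ i, ‖a i‖ ^ 2 + (1 + 1 / t) * ∑ i, ‖b i‖ ^ 2 := by
  rw [Finset.mul_sum, Finset.mul_sum, ← Finset.sum_add_distrib]
  refine Finset.sum_le_sum fun i _ => ?_
  have h1 : ‖a i - b i‖ ≤ ‖a i‖ + ‖b i‖ := norm_sub_le _ _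
  have h2 : ‖a i - b i‖ ^ 2 ≤ (‖a i‖ + ‖b i‖) ^ 2 := by gcongr
  have h3 : 0 ≤ (t * ‖a i‖ - ‖b i‖) ^ 2 / t := by positivity
  have h4 : (t * ‖a i‖ - ‖b i‖) ^ 2 / t =
      t * ‖a i‖ ^ 2 - 2 * ‖a i‖ * ‖b i‖ + 1 / t * ‖b i‖ ^ 2 := by
    field_simp
    ring
  nlinarith

/-- The term linear in the noise is kept exactly, since it will have expectation zero. Centring `n`
does not change it, as the deviations of `u` sum to zero. -/
theorem consensusError_sub_smul_le (hm : 0 < m) (u n : Fin m → Param d) (η : ℝ) :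
    consensusError (fun i => u i - η • n i) ≤ consensusError u -
      2 * η * ∑ i, inner ℝ (u i - paramMean u) (n i) + η ^ 2 * ∑ i, ‖n i‖ ^ 2 := by
  have h1 : consensusError (fun i => u i - η • n i) = consensusError u -
      2 * η * ∑ i, inner ℝ (u i - paramMean u) (n i - paramMean n) +
        η ^ 2 * consensusError n := by
    unfold consensusError
    rw [paramMean_sub, paramMean_smul, Finset.mul_sum, Finset.mul_sum, ← Finset.sum_sub_distrib,
      ← Finset.sum_add_distrib]
    refine Finset.sum_congr rfl fun i _ => ?_
    have : u i - η • n i - (paramMean u - η • paramMean n) =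
        (u i - paramMean u) - η • (n i - paramMean n) := by
      rw [smul_sub]; abel
    rw [this, norm_sub_sq_real, inner_smul_right, norm_smul, mul_pow, Real.norm_eq_abs, sq_abs]
    ring
  have h2 : ∑ i, inner ℝ (u i - paramMean u) (n i - paramMean n) =
      ∑ i, inner ℝ (u i - paramMean u) (n i) := by
    simp only [inner_sub_right _ (n _), Finset.sum_sub_distrib]
    rw [← sum_inner, sum_sub_paramMean hm, inner_zero_left, sub_zero]
  rw [h1, h2]
  have := consensusError_le hm n
  gcongr

theorem paramMean_mix {G : SimpleGraph (Fin m)} {α : G.edgeSet → ℝ} (x : Fin m → Param d) :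
    paramMean (fun i => ∑ j, mixingMatrix G α i j • x j) = paramMean x := by
  unfold paramMean
  rw [Finset.sum_comm]
  simp only [← Finset.sum_smul, mixingMatrix_col_sum, one_smul]

/-- The consensus error after a step of deterministic decentralized gradient descent. -/
theorem consensusError_mix_sub_le (hm : 0 < m) {G A : SimpleGraph (Fin m)} {α : G.edgeSet → ℝ}
    (hα : IsOptimalWeights G A α) (α₀ : G.edgeSet → ℝ) (hρ : rhoBar G A α₀ < 1) (η : ℝ)
    (x h : Fin m → Param d) {p : ℝ} (hp : p = 1 - rhoBar G A α₀ ^ 2) :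
    consensusError (fun i => ∑ j, mixingMatrix G α i j • x j - η • h i) ≤
      (1 - p / 2) * consensusError x + 3 / p * η ^ 2 * ∑ i, ‖h i‖ ^ 2 := by
  have hρ0 := rhoBar_nonneg G A α₀
  have hp0 : 0 < p := by rw [hp]; nlinarith
  have hp1 : p ≤ 1 := by rw [hp]; nlinarith
  have h1 : consensusError (fun i => ∑ j, mixingMatrix G α i j • x j - η • h i) =
      ∑ i, ‖∑ j, mixingMatrix G α i j • (x j - paramMean x) - η • (h i - paramMean h)‖ ^ 2 := by
    unfold consensusError
    rw [paramMean_sub, paramMean_smul, paramMean_mix]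
    refine Finset.sum_congr rfl fun i _ => ?_
    congr 2
    simp only [smul_sub, Finset.sum_sub_distrib, ← Finset.sum_smul, mixingMatrix_row_sum,
      one_smul]
    abel
  -- With `t = p / 2` half of the contraction survives: `(1 + p / 2) * (1 - p) ≤ 1 - p / 2`, at the
  -- price `1 + 2 / p ≤ 3 / p` on the gradients.
  have h2 := sum_norm_sub_sq_le (t := p / 2) (by positivity)
    (fun i => ∑ j, mixingMatrix G α i j • (x j - paramMean x)) fun i => η • (h i - paramMean h)
  have h3 := hα.sum_norm_sq_le α₀ _ (sum_sub_paramMean hm x)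
  have h4 : ∑ i, ‖η • (h i - paramMean h)‖ ^ 2 ≤ η ^ 2 * ∑ i, ‖h i‖ ^ 2 := by
    simp only [norm_smul, mul_pow, Real.norm_eq_abs, sq_abs, ← Finset.mul_sum]
    have := consensusError_le hm h
    unfold consensusError at this
    gcongr
  have h5 : 1 + 1 / (p / 2) ≤ 3 / p := by
    rw [le_div_iff₀ hp0]
    field_simp
    linarith
  have h6 : rhoBar G A α₀ ^ 2 = 1 - p := by rw [hp]; ring
  rw [h6] at h3
  rw [h1]
  have hV := consensusError_nonneg x
  have h7 : 0 ≤ ∑ i, ‖h i‖ ^ 2 := Finset.sum_nonneg fun _ _ => sq_nonneg _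
  calc _ ≤ _ := h2
    _ ≤ (1 + p / 2) * ((1 - p) * consensusError x) + 3 / p * (η ^ 2 * ∑ i, ‖h i‖ ^ 2) := by
        unfold consensusError
        gcongr
    _ ≤ _ := by nlinarith [mul_nonneg (sq_nonneg p) hV]

end Average

/-! ### Expectation of a quadratic function of the noise. -/

section NoiseQuadratic

variable {ι S : Type*} [Fintype ι] [MeasurableSpace S] {D : ι → Measure S}
  [∀ i, IsProbabilityMeasure (D i)] {d : ℕ}

/-- The linear term has mean zero, and by independence both quadratic terms integrate to the total
variance. The one-step bound on the Lyapunov function has this shape. -/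
theorem integral_noise_quadratic {n : ι → S → Param d} (hn : ∀ i, MemLp (n i) 2 (D i))
    (h0 : ∀ i, ∫ s, n i s ∂(D i) = 0) (C q r : ℝ) (a : ι → Param d) :
    Integrable (fun s : ι → S => C + ∑ i, inner ℝ (a i) (n i (s i)) +
        q * ‖∑ i, n i (s i)‖ ^ 2 + r * ∑ i, ‖n i (s i)‖ ^ 2) (Measure.pi D) ∧
      ∫ s, (C + ∑ i, inner ℝ (a i) (n i (s i)) +
        q * ‖∑ i, n i (s i)‖ ^ 2 + r * ∑ i, ‖n i (s i)‖ ^ 2) ∂(Measure.pi D) =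
        C + (q + r) * ∑ i, ∫ s, ‖n i s‖ ^ 2 ∂(D i) := by
  have hpi : ∀ i, MemLp (fun s : ι → S => n i (s i)) 2 (Measure.pi D) := fun i =>
    (hn i).comp_measurePreserving (measurePreserving_eval D i)
  have hlin : ∀ i, Integrable (fun s : ι → S => inner ℝ (a i) (n i (s i))) (Measure.pi D) :=
    fun i => ((hpi i).integrable one_le_two).const_inner (a i)
  have hlin0 : ∀ i, ∫ s : ι → S, inner ℝ (a i) (n i (s i)) ∂(Measure.pi D) = 0 := by
    intro i
    rw [integral_inner ((hpi i).integrable one_le_two),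
      integral_comp_eval (μ := D) (f := n i) (hn i).aestronglyMeasurable, h0 i, inner_zero_right]
  have hsq : ∀ i, Integrable (fun s : ι → S => ‖n i (s i)‖ ^ 2) (Measure.pi D) := fun i =>
    (hpi i).norm.integrable_sq
  have hsum : Integrable (fun s : ι → S => ‖∑ i, n i (s i)‖ ^ 2) (Measure.pi D) :=
    (memLp_finsetSum _ fun i _ => hpi i).norm.integrable_sq
  have i1 : Integrable (fun s : ι → S => ∑ i, inner ℝ (a i) (n i (s i))) (Measure.pi D) :=
    integrable_finsetSum _ fun i _ => hlin i
  have i2 := (integrable_const C).add i1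
  have i3 := hsum.const_mul q
  have i4 : Integrable (fun s : ι → S => r * ∑ i, ‖n i (s i)‖ ^ 2) (Measure.pi D) :=
    (integrable_finsetSum _ fun i _ => hsq i).const_mul r
  refine ⟨(i2.add i3).add i4, ?_⟩
  have e1 := integral_add (i2.add i3) i4
  have e2 := integral_add i2 i3
  have e3 := integral_add (integrable_const (μ := Measure.pi D) C) i1
  simp only [Pi.add_apply] at e1 e2 e3
  rw [e1, e2, e3, integral_const_mul, integral_const_mul, integral_norm_sum_sq_pi hn h0,
    integral_finsetSum _ fun i _ => hlin i, integral_finsetSum _ fun i _ => hsq i]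
  have e4 : ∀ i, ∫ s : ι → S, ‖n i (s i)‖ ^ 2 ∂(Measure.pi D) = ∫ s, ‖n i s‖ ^ 2 ∂(D i) :=
    fun i => integral_comp_eval (μ := D) (f := fun s => ‖n i s‖ ^ 2)
      ((hn i).norm.integrable_sq).aestronglyMeasurable
  simp only [hlin0, e4, integral_const, probReal_univ, smul_eq_mul, Finset.sum_const_zero]
  ring

end NoiseQuadratic

/-! ### One iteration of D-PSGD -/

section Step

variable {m d : ℕ} {S : Type*} [MeasurableSpace S]

/-- One iteration of D-PSGD. -/
noncomputable def dpsgdStep (W : Matrix (Fin m) (Fin m) ℝ) (η : ℝ) (g : Param d → S → Param d)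
    (x : Fin m → Param d) (s : Fin m → S) : Fin m → Param d :=
  fun i => ∑ j, W i j • x j - η • g (x i) (s i)

theorem measurable_dpsgdStep (W : Matrix (Fin m) (Fin m) ℝ) (η : ℝ) {g : Param d → S → Param d}
    (hg : Measurable (Function.uncurry g)) :
    Measurable (Function.uncurry (dpsgdStep W η g)) := by
  refine measurable_pi_lambda _ fun i => ?_
  have h1 : Measurable fun q : (Fin m → Param d) × (Fin m → S) =>
      Function.uncurry g (q.1 i, q.2 i) := hg.comp (by fun_prop)
  have h2 : Measurable fun q : (Fin m → Param d) × (Fin m → S) => ∑ j, W i j • q.1 j := by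
    fun_prop
  exact h2.sub (h1.const_smul η)

/-- The Lyapunov function: the optimality gap of the average plus a multiple of the consensus
error. -/
noncomputable def lyapunov (F : Fin m → Param d → ℝ) (Finf β : ℝ) (x : Fin m → Param d) : ℝ :=
  globalObj F (paramMean x) - Finf + β * (1 / (m : ℝ) * consensusError x)

/-- Smoothness of the objective along one iteration, with the noise `n`. -/
theorem globalObj_paramMean_le (hm : 0 < m) {F : Fin m → Param d → ℝ} {l : ℝ}
    (hF : Differentiable ℝ (globalObj F))
    (hl : ∀ x y, ‖gradient (globalObj F) x - gradient (globalObj F) y‖ ≤ l * ‖x - y‖)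
    (x b : Param d) (n : Fin m → Param d) (η : ℝ) :
    globalObj F (x - η • b - η • paramMean n) ≤
      globalObj F x - η * inner ℝ (gradient (globalObj F) x) b + l / 2 * η ^ 2 * ‖b‖ ^ 2 +
        ∑ i, inner ℝ ((1 / (m : ℝ)) • ((l * η ^ 2) • b - η • gradient (globalObj F) x)) (n i) +
        l * η ^ 2 / (2 * m ^ 2) * ‖∑ i, n i‖ ^ 2 := by
  have hm' : (m : ℝ) ≠ 0 := by positivity
  have h := le_add_inner_gradient_add_sq hF hl x (-(η • (b + paramMean n)))
  have h1 : x + -(η • (b + paramMean n)) = x - η • b - η • paramMean n := by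
    rw [smul_add]; abel
  rw [h1, norm_neg, norm_smul, mul_pow, Real.norm_eq_abs, sq_abs, norm_add_sq_real,
    inner_neg_right, inner_smul_right, inner_add_right] at h
  rw [← inner_sum, inner_smul_left, inner_sub_left, inner_smul_left, inner_smul_left]
  have h2 : ‖paramMean n‖ ^ 2 = 1 / (m : ℝ) ^ 2 * ‖∑ i, n i‖ ^ 2 := by
    rw [paramMean, norm_smul, mul_pow, Real.norm_eq_abs, sq_abs, one_div, inv_pow, one_div]
  have h3 : ∀ v : Param d, inner ℝ v (paramMean n) = 1 / (m : ℝ) * inner ℝ v (∑ i, n i) := by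
    intro v; rw [paramMean, inner_smul_right]
  rw [h2, h3, h3] at h
  refine h.trans (le_of_eq ?_)
  simp only [conj_trivial]
  field_simp
  ring

variable {F : Fin m → Param d → ℝ} {D : Fin m → Measure S} {g : Param d → S → Param d}
  {l σ M₁ ζ M₂ : ℝ}

theorem LearningAssumptions.globalObj_smooth (hm : 0 < m) (hg : IsStochasticGradient F D g)
    (h : LearningAssumptions F D g l σ M₁ ζ M₂) (x y : Param d) :
    ‖gradient (globalObj F) x - gradient (globalObj F) y‖ ≤ l * ‖x - y‖ := by
  have hm' : (0 : ℝ) < m := by exact_mod_cast hm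
  rw [(globalObj_hasGradientAt hg.differentiable x).gradient,
    (globalObj_hasGradientAt hg.differentiable y).gradient, ← smul_sub, ← Finset.sum_sub_distrib,
    norm_smul, Real.norm_of_nonneg (by positivity), one_div, inv_mul_eq_div, div_le_iff₀ hm']
  refine (norm_sum_le _ _).trans ((Finset.sum_le_sum fun i _ => h.smooth i x y).trans ?_)
  simp
  linarith

/-- The local gradients, in terms of the global gradient at the average. -/
theorem LearningAssumptions.sum_norm_gradient_sq_le (hm : 0 < m)
    (h : LearningAssumptions F D g l σ M₁ ζ M₂) (x : Fin m → Param d) :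
    1 / (m : ℝ) * ∑ i, ‖gradient (F i) (x i)‖ ^ 2 ≤
      2 * l ^ 2 * (1 / (m : ℝ) * consensusError x) +
        2 * (ζ ^ 2 + M₂ * ‖gradient (globalObj F) (paramMean x)‖ ^ 2) := by
  have hm' : (0 : ℝ) < m := by exact_mod_cast hm
  have h1 := sum_norm_sub_sq_le one_pos
    (fun i => gradient (F i) (x i) - gradient (F i) (paramMean x))
    fun i => -gradient (F i) (paramMean x)
  simp only [sub_neg_eq_add, sub_add_cancel, norm_neg] at h1
  have h2 : ∑ i, ‖gradient (F i) (x i) - gradient (F i) (paramMean x)‖ ^ 2 ≤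
      l ^ 2 * consensusError x := by
    rw [consensusError, Finset.mul_sum]
    refine Finset.sum_le_sum fun i _ => ?_
    rw [← mul_pow]
    exact pow_le_pow_left₀ (norm_nonneg _) (h.smooth i _ _) 2
  have h3 := h.diversity (paramMean x)
  calc _ ≤ 1 / (m : ℝ) * (2 * (l ^ 2 * consensusError x) +
        2 * ∑ i, ‖gradient (F i) (paramMean x)‖ ^ 2) := by
        gcongr
        linarith
    _ ≤ _ := by linarith

/-- The noise assumption involves the global gradient at the local points; smoothness moves it to
the average at the cost of the consensus error. -/
theorem LearningAssumptions.noise_le (hm : 0 < m) (hM₁ : 0 ≤ M₁)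
    (hg : IsStochasticGradient F D g) (h : LearningAssumptions F D g l σ M₁ ζ M₂)
    (x : Fin m → Param d) :
    1 / (m : ℝ) * ∑ i, ∫ s, ‖g (x i) s - gradient (F i) (x i)‖ ^ 2 ∂(D i) ≤
      σ ^ 2 + 2 * M₁ * (‖gradient (globalObj F) (paramMean x)‖ ^ 2 +
        l ^ 2 * (1 / (m : ℝ) * consensusError x)) := by
  have hm' : (0 : ℝ) < m := by exact_mod_cast hm
  refine (h.noise x).trans ?_
  have h1 : ∑ i, ‖gradient (globalObj F) (x i)‖ ^ 2 ≤
      2 * (l ^ 2 * consensusError x) + 2 * (m * ‖gradient (globalObj F) (paramMean x)‖ ^ 2) := by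
    have h1 := sum_norm_sub_sq_le one_pos
      (fun i => gradient (globalObj F) (x i) - gradient (globalObj F) (paramMean x))
      fun _ => -gradient (globalObj F) (paramMean x)
    simp only [sub_neg_eq_add, sub_add_cancel, norm_neg, Finset.sum_const, Finset.card_univ,
      Fintype.card_fin, nsmul_eq_mul] at h1
    have h2 : ∑ i, ‖gradient (globalObj F) (x i) - gradient (globalObj F) (paramMean x)‖ ^ 2 ≤
        l ^ 2 * consensusError x := by
      rw [consensusError, Finset.mul_sum]
      refine Finset.sum_le_sum fun i _ => ?_
      rw [← mul_pow]
      exact pow_le_pow_left₀ (norm_nonneg _) (h.globalObj_smooth hm hg _ _) 2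
    linarith
  calc _ ≤ σ ^ 2 + M₁ / (m : ℝ) * (2 * (l ^ 2 * consensusError x) +
        2 * (m * ‖gradient (globalObj F) (paramMean x)‖ ^ 2)) := by gcongr
    _ = _ := by field_simp; ring

/-- The drift of the objective along the average of the local gradients. -/
theorem LearningAssumptions.drift_le (hm : 0 < m) (hg : IsStochasticGradient F D g)
    (h : LearningAssumptions F D g l σ M₁ ζ M₂) (x : Fin m → Param d)
    {η : ℝ} (hη : 0 ≤ η) (hηl : η * l ≤ 1) :
    -η * inner ℝ (gradient (globalObj F) (paramMean x))
        (paramMean fun i => gradient (F i) (x i)) +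
      l / 2 * η ^ 2 * ‖paramMean fun i => gradient (F i) (x i)‖ ^ 2 ≤
      -η / 2 * ‖gradient (globalObj F) (paramMean x)‖ ^ 2 +
        η / 2 * (l ^ 2 * (1 / (m : ℝ) * consensusError x)) := by
  set b := paramMean fun i => gradient (F i) (x i) with hb
  set v := gradient (globalObj F) (paramMean x) with hv
  -- Expanding `‖v - b‖ ^ 2` rewrites `-⟪v, b⟫` through squared norms; the leftover multiple of `‖b‖
  -- ^ 2` has the right sign because `η * l ≤ 1`.
  have h1 : ‖v - b‖ ^ 2 ≤ l ^ 2 * (1 / (m : ℝ) * consensusError x) := by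
    have e1 : v = paramMean fun i => gradient (F i) (paramMean x) :=
      (globalObj_hasGradientAt hg.differentiable _).gradient
    rw [norm_sub_rev, e1, hb, ← paramMean_sub]
    refine (norm_paramMean_sq_le hm _).trans ?_
    rw [mul_left_comm, consensusError, Finset.mul_sum (a := l ^ 2)]
    gcongr with i
    rw [← mul_pow]
    exact pow_le_pow_left₀ (norm_nonneg _) (h.smooth i _ _) 2
  rw [norm_sub_sq_real] at h1
  have h2 : 0 ≤ η / 2 * (1 - η * l) * ‖b‖ ^ 2 := by
    have : 0 ≤ 1 - η * l := by linarith
    positivity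
  have h3 := mul_le_mul_of_nonneg_left h1 (div_nonneg hη zero_le_two)
  linarith

end Step

/-- The coefficients in the one-step estimate of the Lyapunov function, whose multiplier is
`4 * η * l ^ 2 / p`. -/
theorem lyapunov_coefficients_le {m l η p M₁ M₂ σ ζ e V : ℝ} (hm : 1 ≤ m) (hl : 0 < l)
    (hη : 0 < η) (hp : 0 < p) (hp1 : p ≤ 1) (hM₁ : 0 ≤ M₁) (hM₂ : 0 ≤ M₂) (he : 0 ≤ e)
    (hV : 0 ≤ V) (h1 : η * l * M₁ ≤ 1 / 4)
    (h2 : 32 * (6 + 2 * M₁) * (M₂ + 1) * (η * l) ^ 2 ≤ p ^ 2) :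
    -η / 2 * e + η / 2 * (l ^ 2 * V) +
      4 * η * l ^ 2 / p * ((1 - p / 2) * V +
        3 / p * η ^ 2 * (2 * l ^ 2 * V + 2 * (ζ ^ 2 + M₂ * e))) +
      (l * η ^ 2 / (2 * m) + 4 * η * l ^ 2 / p * η ^ 2) *
        (σ ^ 2 + 2 * M₁ * (e + l ^ 2 * V)) ≤
    4 * η * l ^ 2 / p * V - η / 8 * e + (l * η ^ 2 * σ ^ 2 / (2 * m) +
      4 * η * l ^ 2 / p * ((6 + 2 * M₁) * η ^ 2 * (ζ ^ 2 / p + σ ^ 2))) := by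
  -- Since `β * p = 4 * η * l ^ 2`, mixing removes `2 * η * l ^ 2 * V`. Half of it absorbs the
  -- gradient and noise feedback into the consensus error; the other half covers the share `3 / 4 *
  -- η * l ^ 2 * V` coming from the objective. For `e`, the losses `η / 4` and `η / 8` leave `η / 8`
  -- of the initial `η / 2`.
  set β := 4 * η * l ^ 2 / p with hβ
  have hβ0 : 0 < β := by positivity
  have hβp : β * p = 4 * η * l ^ 2 := by rw [hβ]; field_simp
  have hinv : 1 ≤ 1 / p := by rw [le_div_iff₀ hp]; linarith
  have hηm : l * η ^ 2 / (2 * m) * (2 * M₁) ≤ η / 4 := by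
    have : l * η ^ 2 / (2 * m) * (2 * M₁) = (η * l * M₁) * η / m := by field_simp
    rw [this, div_le_iff₀ (by linarith)]
    nlinarith [mul_le_mul_of_nonneg_right h1 hη.le, mul_le_mul_of_nonneg_left hm hη.le]
  have hq : 8 * β * (6 + 2 * M₁) * (M₂ + 1) * η ^ 2 ≤ η * p := by
    have h3 : (8 * β * (6 + 2 * M₁) * (M₂ + 1) * η ^ 2) * p =
        η * (32 * (6 + 2 * M₁) * (M₂ + 1) * (η * l) ^ 2) := by
      linear_combination 8 * (6 + 2 * M₁) * (M₂ + 1) * η ^ 2 * hβp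
    refine le_of_mul_le_mul_right ?_ hp
    rw [h3, mul_assoc η p p, ← sq]
    gcongr
  have hq2 : 8 * β * (6 + 2 * M₁) * (M₂ + 1) * η ^ 2 * (1 / p) ≤ η := by
    rw [mul_one_div, div_le_iff₀ hp]; exact hq
  have hs : 4 * (6 + 2 * M₁) * (η * l) ^ 2 ≤ p ^ 2 := by
    have h4 : 0 ≤ (6 + 2 * M₁) * (η * l) ^ 2 := by positivity
    have h5 : 0 ≤ (6 + 2 * M₁) * (η * l) ^ 2 * M₂ := by positivity
    linarith
  have hs2 : (6 + 2 * M₁) * (η * l) ^ 2 * (1 / p) ≤ p / 4 := by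
    rw [mul_one_div, div_le_iff₀ hp]; linarith
  -- the coefficient of `V`
  have cV : η / 2 * l ^ 2 + l * η ^ 2 / (2 * m) * (2 * M₁) * l ^ 2 +
      β * (-p / 2 + 6 * (η * l) ^ 2 * (1 / p) + 2 * M₁ * (η * l) ^ 2) ≤ 0 := by
    have a1 : l * η ^ 2 / (2 * m) * (2 * M₁) * l ^ 2 ≤ η / 4 * l ^ 2 := by gcongr
    have a2 : 2 * M₁ * (η * l) ^ 2 * 1 ≤ 2 * M₁ * (η * l) ^ 2 * (1 / p) := by gcongr
    have a3 : -p / 2 + 6 * (η * l) ^ 2 * (1 / p) + 2 * M₁ * (η * l) ^ 2 ≤ -p / 4 := by linarith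
    have a4 := mul_le_mul_of_nonneg_left a3 hβ0.le
    have a5 : 0 ≤ η * l ^ 2 := by positivity
    linarith
  -- the coefficient of `e`
  have ce : l * η ^ 2 / (2 * m) * (2 * M₁) + β * (6 * η ^ 2 * M₂ * (1 / p) + 2 * M₁ * η ^ 2) ≤
      3 * η / 8 := by
    have a1 : 2 * M₁ * η ^ 2 * 1 ≤ 2 * M₁ * η ^ 2 * (1 / p) := by gcongr
    have a2 : 0 ≤ η ^ 2 * (1 / p) * (6 + 2 * M₁ * M₂) := by positivity
    have a3 : 6 * η ^ 2 * M₂ * (1 / p) + 2 * M₁ * η ^ 2 ≤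
        (6 + 2 * M₁) * (M₂ + 1) * η ^ 2 * (1 / p) := by linarith
    have a4 := mul_le_mul_of_nonneg_left a3 hβ0.le
    linarith
  -- the constant term
  have cσ : 6 * ζ ^ 2 * (1 / p) + σ ^ 2 ≤ (6 + 2 * M₁) * (ζ ^ 2 * (1 / p) + σ ^ 2) := by
    have a1 : 0 ≤ 2 * M₁ * (ζ ^ 2 * (1 / p)) := by positivity
    have a2 : 0 ≤ (5 + 2 * M₁) * σ ^ 2 := by positivity
    linarith
  have cσ' : β * η ^ 2 * (6 * ζ ^ 2 * (1 / p) + σ ^ 2) ≤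
      β * η ^ 2 * ((6 + 2 * M₁) * (ζ ^ 2 * (1 / p) + σ ^ 2)) := by gcongr
  have cV' := mul_le_mul_of_nonneg_right cV hV
  have ce' := mul_le_mul_of_nonneg_right ce he
  have r1 : 3 / p = 3 * (1 / p) := by ring
  have r2 : ζ ^ 2 / p = ζ ^ 2 * (1 / p) := by ring
  have r3 : l * η ^ 2 * σ ^ 2 / (2 * m) = l * η ^ 2 / (2 * m) * σ ^ 2 := by ring
  rw [r1, r2, r3]
  linarith

/-! ### Expected decrease of the Lyapunov function. -/

section OneStep

variable {m d : ℕ} {S : Type*} [MeasurableSpace S]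
  {F : Fin m → Param d → ℝ} {D : Fin m → Measure S} {g : Param d → S → Param d}
  {l σ M₁ ζ M₂ : ℝ}

theorem sum_inner_sub_smul (w : Param d) (c : ℝ) (y n : Fin m → Param d) :
    ∑ i, inner ℝ (w - c • y i) (n i) = ∑ i, inner ℝ w (n i) - c * ∑ i, inner ℝ (y i) (n i) := by
  simp only [inner_sub_left, real_inner_smul_left, Finset.sum_sub_distrib, Finset.mul_sum]

theorem continuous_paramMean : Continuous (paramMean : (Fin m → Param d) → Param d) := by
  unfold paramMean; fun_prop

theorem measurable_lyapunov (hg : IsStochasticGradient F D g) (Finf β : ℝ) :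
    Measurable (lyapunov F Finf β) := by
  have h1 : Continuous (globalObj F) := Differentiable.continuous fun x =>
    (globalObj_hasGradientAt hg.differentiable x).differentiableAt
  have h2 := continuous_paramMean (m := m) (d := d)
  have : Continuous (lyapunov F Finf β) := by
    unfold lyapunov consensusError
    fun_prop
  exact this.measurable

/-- The step splits into a deterministic one, `u`, and centred noise. A pointwise bound quadratic in
the noise is integrated first; the drift, mixing and noise estimates are combined afterwards. -/
theorem lyapunov_dpsgdStep (hm : 0 < m) (hl : 0 < l) (hM₁ : 0 ≤ M₁) (hM₂ : 0 ≤ M₂)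
    (hg : IsStochasticGradient F D g) (h : LearningAssumptions F D g l σ M₁ ζ M₂)
    {Finf : ℝ} (hFinf : ∀ x, Finf ≤ globalObj F x)
    {G A : SimpleGraph (Fin m)} {α : G.edgeSet → ℝ} (hα : IsOptimalWeights G A α)
    (α₀ : G.edgeSet → ℝ) (hρ : rhoBar G A α₀ < 1) {p : ℝ} (hp : p = 1 - rhoBar G A α₀ ^ 2)
    {η : ℝ} (hη : 0 < η) (hηl : η * l ≤ 1) (h1 : η * l * M₁ ≤ 1 / 4)
    (h2 : 32 * (6 + 2 * M₁) * (M₂ + 1) * (η * l) ^ 2 ≤ p ^ 2) (x : Fin m → Param d) :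
    Integrable (fun s => lyapunov F Finf (4 * η * l ^ 2 / p)
        (dpsgdStep (mixingMatrix G α) η g x s)) (Measure.pi D) ∧
      ∫ s, lyapunov F Finf (4 * η * l ^ 2 / p) (dpsgdStep (mixingMatrix G α) η g x s)
          ∂(Measure.pi D) ≤
        lyapunov F Finf (4 * η * l ^ 2 / p) x -
          η / 8 * ‖gradient (globalObj F) (paramMean x)‖ ^ 2 +
          (l * η ^ 2 * σ ^ 2 / (2 * m) +
            4 * η * l ^ 2 / p * ((6 + 2 * M₁) * η ^ 2 * (ζ ^ 2 / p + σ ^ 2))) := by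
  have := hg.prob
  have hρ0 := rhoBar_nonneg G A α₀
  have hp0 : 0 < p := by rw [hp]; nlinarith
  have hp1 : p ≤ 1 := by rw [hp]; nlinarith
  have hm' : (0 : ℝ) < m := by exact_mod_cast hm
  set β := 4 * η * l ^ 2 / p with hβ
  have hβ0 : 0 < β := by positivity
  set v := gradient (globalObj F) (paramMean x) with hv
  set b := paramMean (fun i => gradient (F i) (x i)) with hb
  set n : Fin m → S → Param d := fun i s => g (x i) s - gradient (F i) (x i) with hn
  set u : Fin m → Param d := fun i =>
    ∑ j, mixingMatrix G α i j • x j - η • gradient (F i) (x i) with hu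
  have hgm : ∀ i, Measurable (g (x i)) := fun i => hg.measurable.comp measurable_prodMk_left
  have hnm : ∀ i, Measurable (n i) := fun i => (hgm i).sub_const _
  have hn2 : ∀ i, MemLp (n i) 2 (D i) := fun i =>
    (memLp_two_iff_integrable_sq_norm (hnm i).aestronglyMeasurable).2
      (h.noise_integrable i (x i))
  have hn0 : ∀ i, ∫ s, n i s ∂(D i) = 0 := fun i => by
    simp only [hn]
    rw [integral_sub (hg.integrable i _) (integrable_const _), hg.unbiased]
    simp
  have hstep : ∀ s, dpsgdStep (mixingMatrix G α) η g x s = fun i => u i - η • n i (s i) := by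
    intro s
    funext i
    simp only [dpsgdStep, hu, hn, smul_sub]
    abel
  have humean : paramMean u = paramMean x - η • b := by
    rw [hu, paramMean_sub, paramMean_smul, paramMean_mix]
  set a : Fin m → Param d := fun i =>
    (1 / (m : ℝ)) • ((l * η ^ 2) • b - η • v) -
      (β * (1 / (m : ℝ)) * (2 * η)) • (u i - paramMean u) with ha
  set C := globalObj F (paramMean x) - η * inner ℝ v b + l / 2 * η ^ 2 * ‖b‖ ^ 2 - Finf +
    β * (1 / (m : ℝ) * consensusError u) with hC
  -- The factor `1 / m ^ 2` comes from averaging the noise. Against a sum over `m` agents it leaves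
  -- `σ ^ 2 / m`, the linear speedup.
  set q := l * η ^ 2 / (2 * (m : ℝ) ^ 2) with hq
  set r := β * (1 / (m : ℝ)) * η ^ 2 with hr
  obtain ⟨hBint, hBval⟩ := integral_noise_quadratic hn2 hn0 C q r a
  have hpt : ∀ s : Fin m → S, lyapunov F Finf β (dpsgdStep (mixingMatrix G α) η g x s) ≤
      C + ∑ i, inner ℝ (a i) (n i (s i)) + q * ‖∑ i, n i (s i)‖ ^ 2 +
        r * ∑ i, ‖n i (s i)‖ ^ 2 := by
    intro s
    rw [hstep s, lyapunov]
    have k1 := globalObj_paramMean_le hm (fun y =>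
      (globalObj_hasGradientAt hg.differentiable y).differentiableAt)
      (h.globalObj_smooth hm hg) (paramMean x) b (fun i => n i (s i)) η
    have k2 := consensusError_sub_smul_le hm u (fun i => n i (s i)) η
    have k3 := mul_le_mul_of_nonneg_left (mul_le_mul_of_nonneg_left k2
      (one_div_nonneg.2 hm'.le)) hβ0.le
    have k4 : ∑ i, inner ℝ (a i) (n i (s i)) =
        ∑ i, inner ℝ ((1 / (m : ℝ)) • ((l * η ^ 2) • b - η • v)) (n i (s i)) -
          β * (1 / (m : ℝ)) * (2 * η) * ∑ i, inner ℝ (u i - paramMean u) (n i (s i)) :=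
      sum_inner_sub_smul _ _ _ _
    rw [paramMean_sub, paramMean_smul, humean, k4]
    linarith
  have hpos : ∀ y, 0 ≤ lyapunov F Finf β y := fun y => by
    have k1 := hFinf (paramMean y)
    have k2 := consensusError_nonneg y
    have k3 : 0 ≤ β * (1 / (m : ℝ) * consensusError y) := by positivity
    unfold lyapunov
    linarith
  have hmeas : Measurable fun s =>
      lyapunov F Finf β (dpsgdStep (mixingMatrix G α) η g x s) :=
    (measurable_lyapunov hg Finf β).comp
      (measurable_dpsgdStep (mixingMatrix G α) η hg.measurable).of_uncurry_left
  -- Integrability is free: the Lyapunov function is nonnegative and lies below the integrable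
  -- quadratic.
  have hint : Integrable (fun s => lyapunov F Finf β
      (dpsgdStep (mixingMatrix G α) η g x s)) (Measure.pi D) := hBint.mono' hmeas.aestronglyMeasurable (Filter.Eventually.of_forall fun s => by
    rw [Real.norm_of_nonneg (hpos _)]; exact hpt s)
  refine ⟨hint, ?_⟩
  have hmono := integral_mono hint hBint hpt
  rw [hBval] at hmono
  refine hmono.trans ?_
  have d1 := h.drift_le hm hg x hη.le hηl
  have d2 := consensusError_mix_sub_le hm hα α₀ hρ η x (fun i => gradient (F i) (x i)) hp
  have d3 := h.sum_norm_gradient_sq_le hm x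
  have d4 := h.noise_le hm hM₁ hg x
  have d5 := lyapunov_coefficients_le (σ := σ) (ζ := ζ) (m := (m : ℝ))
    (e := ‖v‖ ^ 2) (V := 1 / (m : ℝ) * consensusError x) (by exact_mod_cast hm) hl hη hp0 hp1
    hM₁ hM₂ (sq_nonneg _) (mul_nonneg (by positivity) (consensusError_nonneg x)) h1 h2
  rw [← hv, ← hb] at d1
  have e1 : β * (1 / (m : ℝ) * consensusError u) ≤ β * ((1 - p / 2) *
      (1 / (m : ℝ) * consensusError x) + 3 / p * η ^ 2 * (2 * l ^ 2 *
        (1 / (m : ℝ) * consensusError x) + 2 * (ζ ^ 2 + M₂ * ‖v‖ ^ 2))) := by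
    gcongr
    calc 1 / (m : ℝ) * consensusError u
        ≤ 1 / (m : ℝ) * ((1 - p / 2) * consensusError x +
          3 / p * η ^ 2 * ∑ i, ‖gradient (F i) (x i)‖ ^ 2) := by gcongr
      _ = (1 - p / 2) * (1 / (m : ℝ) * consensusError x) +
          3 / p * η ^ 2 * (1 / (m : ℝ) * ∑ i, ‖gradient (F i) (x i)‖ ^ 2) := by ring
      _ ≤ _ := by gcongr
  have e2 : (q + r) * ∑ i, ∫ s, ‖n i s‖ ^ 2 ∂(D i) ≤
      (l * η ^ 2 / (2 * m) + β * η ^ 2) * (σ ^ 2 + 2 * M₁ * (‖v‖ ^ 2 +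
        l ^ 2 * (1 / (m : ℝ) * consensusError x))) := by
    have : q + r = (l * η ^ 2 / (2 * m) + β * η ^ 2) * (1 / (m : ℝ)) := by
      rw [hq, hr]; field_simp
    rw [this, mul_assoc]
    gcongr
  unfold lyapunov
  linarith

end OneStep

/-! ### Convergence of D-PSGD -/

section Convergence

variable {m d : ℕ} {S Ω : Type*} [MeasurableSpace S] [MeasurableSpace Ω]
  {P : Measure Ω} [IsProbabilityMeasure P]
  {F : Fin m → Param d → ℝ} {D : Fin m → Measure S} {g : Param d → S → Param d}
  {l σ M₁ ζ M₂ : ℝ} {ξ : ℕ → Fin m → Ω → S}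

/-- The convergence rate of D-PSGD for a given learning rate. -/
theorem dpsgd_sum_le (hm : 0 < m) (hl : 0 < l) (hM₁ : 0 ≤ M₁) (hM₂ : 0 ≤ M₂)
    (hg : IsStochasticGradient F D g) (h : LearningAssumptions F D g l σ M₁ ζ M₂)
    (hξ : IsMiniBatchProcess D P ξ) {Finf : ℝ} (hFinf : ∀ x, Finf ≤ globalObj F x)
    {G A : SimpleGraph (Fin m)} {α : G.edgeSet → ℝ} (hα : IsOptimalWeights G A α)
    (α₀ : G.edgeSet → ℝ) (hρ : rhoBar G A α₀ < 1) {p : ℝ} (hp : p = 1 - rhoBar G A α₀ ^ 2)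
    {η : ℝ} (hη : 0 < η) (hηl : η * l ≤ 1) (h1 : η * l * M₁ ≤ 1 / 4)
    (h2 : 32 * (6 + 2 * M₁) * (M₂ + 1) * (η * l) ^ 2 ≤ p ^ 2) (x₁ : Param d) :
    (∀ k, Integrable (fun ω => ‖gradient (globalObj F)
        (agentMean (dpsgd (mixingMatrix G α) η g ξ x₁ k) ω)‖ ^ 2) P) ∧
      ∀ K : ℕ, η / 8 * ∑ k ∈ Finset.range K, ∫ ω, ‖gradient (globalObj F)
          (agentMean (dpsgd (mixingMatrix G α) η g ξ x₁ k) ω)‖ ^ 2 ∂P ≤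
        globalObj F x₁ - Finf + K * (l * η ^ 2 * σ ^ 2 / (2 * m) +
          4 * η * l ^ 2 / p * ((6 + 2 * M₁) * η ^ 2 * (ζ ^ 2 / p + σ ^ 2))) := by
  have := hg.prob
  have hρ0 := rhoBar_nonneg G A α₀
  have hp0 : 0 < p := by rw [hp]; nlinarith
  set X : ℕ → Ω → Fin m → Param d := fun k ω i => dpsgd (mixingMatrix G α) η g ξ x₁ k i ω
    with hX
  have hstep := measurable_dpsgdStep (mixingMatrix G α) η hg.measurable
  have hrec : ∀ k ω, X (k + 1) ω =
      dpsgdStep (mixingMatrix G α) η g (X k ω) fun i => ξ k i ω := fun k ω => rfl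
  have hlaw := map_state_noise_eq_prod hξ.measurable hξ.law hξ.indep hstep (fun _ => x₁)
    (fun ω => rfl : ∀ ω, X 0 ω = _) hrec
  have hmean : paramMean (fun _ : Fin m => x₁) = x₁ := by
    have : (m : ℝ) ≠ 0 := by positivity
    rw [paramMean, Finset.sum_const, Finset.card_univ, Fintype.card_fin,
      ← Nat.cast_smul_eq_nsmul ℝ, smul_smul, one_div_mul_cancel this, one_smul]
  have hgrad : Continuous (gradient (globalObj F)) :=
    continuous_gradient_of_lipschitz (h.globalObj_smooth hm hg)
  exact lyapunov_sum_le (π := Measure.pi D) (X := X) (ξ := fun k ω i => ξ k i ω)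
    (fun k => (hlaw k).1) (fun k => measurable_pi_lambda _ (hξ.measurable k)) hstep hrec
    (fun k => (hlaw k).2) (Φ := lyapunov F Finf (4 * η * l ^ 2 / p))
    (e := fun x => ‖gradient (globalObj F) (paramMean x)‖ ^ 2) (measurable_lyapunov hg _ _)
    ((hgrad.comp continuous_paramMean).norm.pow 2).measurable
    (fun y => by
      have k1 := hFinf (paramMean y)
      have k2 := consensusError_nonneg y
      have k3 : 0 ≤ 4 * η * l ^ 2 / p * (1 / (m : ℝ) * consensusError y) := by positivity
      unfold lyapunov
      linarith)
    (fun _ => sq_nonneg _) (by positivity)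
    (fun x => (lyapunov_dpsgdStep hm hl hM₁ hM₂ hg h hFinf hα α₀ hρ hp hη hηl h1 h2 x).1)
    (fun x => (lyapunov_dpsgdStep hm hl hM₁ hM₂ hg h hFinf hα α₀ hρ hp hη hηl h1 h2 x).2)
    -- With a common starting point the consensus error vanishes, so the initial value is just the
    -- optimality gap.
    (fun ω => by
      have : X 0 ω = fun _ => x₁ := rfl
      rw [this, lyapunov, consensusError, hmean]
      simp)

end Convergence

/-- The choice of the learning rate. -/
theorem exists_learning_rate {m : ℕ} (hm : 0 < m) {l gap σ ζ M₁ M₂ ε p : ℝ} (hl : 0 < l)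
    (hgap : 0 ≤ gap) (hσ : 0 ≤ σ) (hζ : 0 ≤ ζ) (hM₁ : 0 ≤ M₁) (hM₂ : 0 ≤ M₂) (hε : 0 < ε)
    (hp : 0 < p) (hp1 : p ≤ 1) :
    ∃ η : ℝ, 0 < η ∧ η * l ≤ 1 ∧ η * l * M₁ ≤ 1 / 4 ∧
      32 * (6 + 2 * M₁) * (M₂ + 1) * (η * l) ^ 2 ≤ p ^ 2 ∧
      l * η ^ 2 * σ ^ 2 / (2 * m) +
        4 * η * l ^ 2 / p * ((6 + 2 * M₁) * η ^ 2 * (ζ ^ 2 / p + σ ^ 2)) ≤ η * ε / 16 ∧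
      128 * (gap / (η * ε)) ≤ iterBound (4096 * (M₁ + 1)) m l gap σ ζ M₁ M₂ ε p 1 := by
  have hm' : (0 : ℝ) < m := by exact_mod_cast hm
  have hsε : 0 < √ε := Real.sqrt_pos.2 hε
  have hsp : 0 < √p := Real.sqrt_pos.2 hp
  have hsM : 1 ≤ √(M₂ + 1) := Real.one_le_sqrt.2 (by linarith)
  have hsM1 : 1 ≤ √(M₁ + 1) := Real.one_le_sqrt.2 (by linarith)
  have sqε : √ε ^ 2 = ε := Real.sq_sqrt hε.le
  have sqp : √p ^ 2 = p := Real.sq_sqrt hp.le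
  have sqM : √(M₂ + 1) ^ 2 = M₂ + 1 := Real.sq_sqrt (by linarith)
  -- `Q` carries all numerical constants and the dependence on `M₁`. The binding requirement is `512
  -- * (6 + 2 * M₁) ≤ 3 * Q ^ 2`, an equality at `M₁ = 0`; the final constant is `4096 = 128 * 32`.
  set Q := 32 * (M₁ + 1) with hQ
  have hQ0 : 0 < Q := by positivity
  -- Up to `Q`, each `sᵢ` is the reciprocal of the largest `η * l` meeting one requirement:
  -- stability, averaged noise, diversity, and noise fed through the consensus error. The reciprocal
  -- of their sum `T` meets all four, and `T / ε` reproduces the terms of the iteration bound.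
  set s₁ := √(M₂ + 1) / p with hs₁
  set s₂ := σ ^ 2 / (ε * m) with hs₂
  set s₃ := ζ / (p * √ε) with hs₃
  set s₄ := σ * √p / (p * √ε) with hs₄
  have p1 : 0 < s₁ := by positivity
  have p2 : 0 ≤ s₂ := by positivity
  have p3 : 0 ≤ s₃ := by positivity
  have p4 : 0 ≤ s₄ := by positivity
  set T := s₁ + s₂ + s₃ + s₄ with hT
  have hT0 : 0 < T := by positivity
  set y := 1 / (Q * T) with hy
  have hy0 : 0 < y := by positivity
  have hyT : y * Q * T = 1 := by rw [hy]; field_simp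
  have hyQ : 0 < y * Q := by positivity
  have part : ∀ t, t ≤ T → y * Q * t ≤ 1 := fun t ht =>
    (mul_le_mul_of_nonneg_left ht hyQ.le).trans hyT.le
  have b1 := part s₁ (by linarith)
  have b2 := part s₂ (by linarith)
  have b3 := part s₃ (by linarith)
  have b4 := part s₄ (by linarith)
  have hs1 : 1 ≤ s₁ := by rw [hs₁, le_div_iff₀ hp]; linarith
  have hyQ1 : y * Q ≤ 1 := (le_mul_of_one_le_right hyQ.le hs1).trans b1
  have c1 : (y * Q) ^ 2 * (M₂ + 1) ≤ p ^ 2 := by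
    have e : (y * Q) ^ 2 * (M₂ + 1) = (y * Q * s₁) ^ 2 * p ^ 2 := by
      rw [mul_pow _ s₁, hs₁, div_pow, sqM, mul_assoc, div_mul_cancel₀ _ (pow_ne_zero 2 hp.ne')]
    rw [e]
    exact mul_le_of_le_one_left (sq_nonneg p) (pow_le_one₀ (by positivity) b1)
  have c2 : y * Q * (σ ^ 2 / m) ≤ ε := by
    have e : y * Q * (σ ^ 2 / m) = y * Q * s₂ * ε := by
      have : s₂ * ε = σ ^ 2 / m := by rw [hs₂]; field_simp
      rw [mul_assoc _ s₂, this]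
    rw [e]
    exact mul_le_of_le_one_left hε.le b2
  have c3 : (y * Q) ^ 2 * (ζ ^ 2 / p ^ 2) ≤ ε := by
    have e : (y * Q) ^ 2 * (ζ ^ 2 / p ^ 2) = (y * Q * s₃) ^ 2 * ε := by
      have : s₃ ^ 2 * ε = ζ ^ 2 / p ^ 2 := by
        rw [hs₃, div_pow, mul_pow, sqε]; field_simp
      rw [mul_pow _ s₃, mul_assoc, this]
    rw [e]
    exact mul_le_of_le_one_left hε.le (pow_le_one₀ (by positivity) b3)
  have c4 : (y * Q) ^ 2 * (σ ^ 2 / p) ≤ ε := by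
    have e : (y * Q) ^ 2 * (σ ^ 2 / p) = (y * Q * s₄) ^ 2 * ε := by
      have : s₄ ^ 2 * ε = σ ^ 2 / p := by
        rw [hs₄, div_pow, mul_pow, mul_pow, sqp, sqε]; field_simp
      rw [mul_pow _ s₄, mul_assoc, this]
    rw [e]
    exact mul_le_of_le_one_left hε.le (pow_le_one₀ (by positivity) b4)
  have hyl : y / l * l = y := by field_simp
  have hQ2 : 512 * (6 + 2 * M₁) ≤ 3 * Q ^ 2 := by
    rw [hQ, mul_pow]; linarith [sq_nonneg M₁, add_sq M₁ 1]
  have hyM : 0 ≤ y * M₁ := mul_nonneg hy0.le hM₁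
  refine ⟨y / l, by positivity, ?_, ?_, ?_, ?_, ?_⟩
  · rw [hyl]; rw [hQ] at hyQ1; linarith
  · rw [hyl]; rw [hQ] at hyQ1; linarith
  · rw [hyl]
    refine le_trans ?_ c1
    have : 32 * (6 + 2 * M₁) ≤ Q ^ 2 := by linarith
    calc 32 * (6 + 2 * M₁) * (M₂ + 1) * y ^ 2 ≤ Q ^ 2 * (M₂ + 1) * y ^ 2 := by gcongr
      _ = _ := by ring
  · have e : l * (y / l) ^ 2 * σ ^ 2 / (2 * m) +
        4 * (y / l) * l ^ 2 / p * ((6 + 2 * M₁) * (y / l) ^ 2 * (ζ ^ 2 / p + σ ^ 2)) =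
        y / l * (y * (σ ^ 2 / m) / 2 +
          4 * (6 + 2 * M₁) * y ^ 2 * (ζ ^ 2 / p ^ 2 + σ ^ 2 / p)) := by
      field_simp
    rw [e, mul_div_assoc (y / l) ε]
    have hyl0 : 0 ≤ y / l := by positivity
    refine mul_le_mul_of_nonneg_left ?_ hyl0
    -- Budget for `ε / 16`: the averaged noise takes `ε / 64`, and the consensus terms take `3 * ε /
    -- 64`.
    have k1 : 32 * (y * (σ ^ 2 / m)) ≤ ε := by
      have : 0 ≤ y * (σ ^ 2 / m) * M₁ := by positivity
      rw [hQ] at c2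
      linarith
    have k2 : 512 * (6 + 2 * M₁) * (y ^ 2 * (ζ ^ 2 / p ^ 2 + σ ^ 2 / p)) ≤
        3 * Q ^ 2 * (y ^ 2 * (ζ ^ 2 / p ^ 2 + σ ^ 2 / p)) := by gcongr
    linarith
  · have hpow : ε ^ (3 / 2 : ℝ) = ε * √ε := by
      rw [Real.sqrt_eq_rpow, show (3 / 2 : ℝ) = 1 + 1 / 2 by norm_num, Real.rpow_add hε,
        Real.rpow_one]
    have e : 128 * (gap / (y / l * ε)) = l * gap * (4096 * (M₁ + 1) * (T / ε)) := by
      have : 1 / y = Q * T := by rw [hy, one_div_one_div]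
      calc 128 * (gap / (y / l * ε)) = 128 * gap * l * (1 / y) / ε := by field_simp
        _ = _ := by rw [this, hQ]; ring
    rw [e, iterBound]
    have hTε : T / ε = σ ^ 2 / (m * ε ^ 2) + (ζ + σ * √p) / (p * (ε * √ε)) +
        √(M₂ + 1) / (p * ε) := by
      have d1 : ε * m * ε = m * ε ^ 2 := by ring
      have d2 : p * √ε * ε = p * (ε * √ε) := by ring
      rw [hT, hs₁, hs₂, hs₃, hs₄, add_div, add_div, add_div, div_div, div_div, div_div, div_div,
        d1, d2, add_div ζ]
      ring
    have hroot : √(M₂ + 1) ≤ √((M₂ + 1) * (M₁ + 1)) :=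
      Real.sqrt_le_sqrt (le_mul_of_one_le_right (by linarith) (by linarith))
    have hζ' : ζ ≤ ζ * √(M₁ + 1) := le_mul_of_one_le_right hζ hsM1
    rw [hTε, hpow]
    simp only [Nat.cast_one, mul_one, one_mul]
    gcongr

theorem mainTheorem1 (M₁ : ℝ) (hM₁ : 0 ≤ M₁) :
    ∃ c : ℝ, 0 < c ∧
      ∀ (m : ℕ) (_ : 0 < m)
        -- the network, the tomography output, and the activated links
        (Node Link : Type*) [Finite Link] (U : Underlay Node Link) (O : Overlay m U)
        (T : Tomography O)
        (_ : ∀ F ∈ O.nonemptyCategories, F.Nonempty → F ∈ T.detected)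
        (_ : ∀ F ∈ O.nonemptyCategories, F.Nonempty → T.cap F ≤ O.categoryCap F)
        (A : SimpleGraph (Fin m)) (_ : A ≤ O.base)
        -- the predetermined weights, for which `1 - ρ̄²` lies in `(0, 1]`
        (α₀ : O.base.edgeSet → ℝ) (_ : rhoBar O.base A α₀ < 1)
        -- the design: optimized link weights and optimized communication schedule
        (α : O.base.edgeSet → ℝ) (_ : IsOptimalWeights O.base A α)
        (M : ℝ) (_ : IsRateBound T A M)
        (s : Schedule m) (τ : ℝ) (_ : s.IsOptimal T A M τ)
        -- the learning task
        (d : ℕ) (S Ω : Type*) [MeasurableSpace S] [MeasurableSpace Ω]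
        (P : Measure Ω) [IsProbabilityMeasure P]
        (F : Fin m → Param d → ℝ) (D : Fin m → Measure S) (g : Param d → S → Param d)
        (_ : IsStochasticGradient F D g)
        (l σ ζ M₂ : ℝ) (_ : 0 < l) (_ : 0 ≤ σ) (_ : 0 ≤ ζ) (_ : 0 ≤ M₂)
        (_ : LearningAssumptions F D g l σ M₁ ζ M₂)
        (ξ : ℕ → Fin m → Ω → S) (_ : IsMiniBatchProcess D P ξ)
        (Finf : ℝ) (_ : ∀ x, Finf ≤ globalObj F x)
        (x₁ : Param d) (ε : ℝ) (_ : 0 < ε),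
        -- over the true underlay, the schedule completes every iteration within time `τ`
        s.Serves O A M τ ∧ s.RespectsUnderlay O A ∧
        -- and for a suitable learning rate, `N` iterations suffice, which take time `N * τ`
        ∃ η : ℝ, 0 < η ∧ ∃ N : ℕ,
          (N : ℝ) ≤ KBar c O.base A α₀ l (globalObj F x₁ - Finf) σ ζ M₁ M₂ ε ∧
          (N : ℝ) * τ ≤
            tauBar T A * KBar c O.base A α₀ l (globalObj F x₁ - Finf) σ ζ M₁ M₂ ε ∧
          ∀ K : ℕ, 1 ≤ K → N ≤ K →
            EpsConverged P F (dpsgd (mixingMatrix O.base α) η g ξ x₁) ε K := by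
  refine ⟨4096 * (M₁ + 1), by positivity, ?_⟩
  intro m hm Node Link _ U O T hdet hcap A hA α₀ hρ α hα M hM s τ hs d S Ω _ _ P _ F D g hg
    l σ ζ M₂ hl hσ hζ hM₂ hL ξ hξ Finf hFinf x₁ ε hε
  refine ⟨hs.1.1, hs.1.2.respectsUnderlay hdet hcap, ?_⟩
  have hρ0 := rhoBar_nonneg O.base A α₀
  set p := 1 - rhoBar O.base A α₀ ^ 2 with hp
  have hp0 : 0 < p := by rw [hp]; nlinarith
  have hp1 : p ≤ 1 := by rw [hp]; nlinarith
  have hgap : 0 ≤ globalObj F x₁ - Finf := sub_nonneg.2 (hFinf x₁)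
  obtain ⟨η, hη, hηl, h1, h2, hR, hK⟩ :=
    exists_learning_rate hm hl hgap hσ hζ hM₁ hM₂ hε hp0 hp1
  set κ := KBar (4096 * (M₁ + 1)) O.base A α₀ l (globalObj F x₁ - Finf) σ ζ M₁ M₂ ε with hκ
  change 128 * ((globalObj F x₁ - Finf) / (η * ε)) ≤ κ at hK
  have hκ0 : 0 ≤ κ := le_trans (by positivity) hK
  -- Taking only `κ / 2` iterations compensates for `τ ≤ 2 * tauBar`.
  have hN : (⌊κ / 2⌋₊ : ℝ) ≤ κ / 2 := Nat.floor_le (by positivity)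
  have hτ := hs.le_two_mul_tauBar hA hM
  refine ⟨η, hη, ⌊κ / 2⌋₊, by linarith, ?_, ?_⟩
  · calc (⌊κ / 2⌋₊ : ℝ) * τ ≤ κ / 2 * τ := mul_le_mul_of_nonneg_right hN hs.1.1.time_nonneg
      _ ≤ κ / 2 * (2 * tauBar T A) := by gcongr
      _ = tauBar T A * κ := by ring
  · intro K hK1 hNK
    have hK1' : (1 : ℝ) ≤ K := by exact_mod_cast hK1
    have hNK' : (⌊κ / 2⌋₊ : ℝ) ≤ K := by exact_mod_cast hNK
    -- As `K ≥ 1` and `K ≥ N`, `κ / 2 < N + 1 ≤ 2 * K`, even when `N = 0`. Hence `κ ≤ 4 * K`, the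
    -- gap is at most `K * η * ε / 32`, and `1 / 32 + 1 / 16 ≤ 1 / 8` closes the estimate.
    have hlt := Nat.lt_floor_add_one (κ / 2)
    obtain ⟨hint, hsum⟩ :=
      dpsgd_sum_le hm hl hM₁ hM₂ hg hL hξ hFinf hα α₀ hρ hp hη hηl h1 h2 x₁
    refine ⟨fun k _ => hint k, ?_⟩
    have hsumK := hsum K
    have hgapK : globalObj F x₁ - Finf ≤ K / 32 * (η * ε) := by
      rw [← div_le_iff₀ (by positivity)]
      linarith
    have hRK := mul_le_mul_of_nonneg_left hR (by positivity : (0 : ℝ) ≤ K)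
    rw [one_div, inv_mul_eq_div, div_le_iff₀ (by linarith)]
    refine le_of_mul_le_mul_left (hsumK.trans ?_) (by positivity : 0 < η / 8)
    have : 0 ≤ K * (η * ε) := by positivity
    linarith
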